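/- Setting. Let $\mathbb T_1\subset\mathbb T_2\subset\cdots$ be time grids, each of the form $\{0=t_0<t_1<\cdots\}$ with $t_n\to\infty$, such that $\sup_{t_i\in\mathbb T_N}|t_{i+1}-t_i|\to0$ as $N\to\infty$. Let $r:[0,\infty)\to\mathbb R$ be measurable with $\int_0^t|r_s|\,ds<\infty$ for all $t>0$, and let $B_t=\exp(\int_0^t r_s\,ds)$. Let $S:[0,\infty)\to(0,\infty)$ be continuous and admit the continuous quadratic variation $[S]$ along $(\mathbb T_N)$, i.e. for each $t>0$ the limit $$[S]_t=\lim_{N\to\infty}\sum_{t_i,t_{i+1}\in\mathbb T_N,\;t_{i+1}\le t}(S_{t_{i+1}}-S_{t_i})^2$$ exists and, with $[S]_0=0$, is a continuous function of $t\ge0$. A function $\xi:[0,\infty)\to\mathbb R$ is an *admissible integrand for $S$* if for each $T>0$ there are $n\in\mathbb N$, $g\in C^1(\mathbb R^{n+1})$ and a continuous $A:[0,\infty)\to\mathbb R^n$ with components of finite variation on $[0,T]$ such that $\xi_t=g(A_t,S_t)$ for $0\le t\le T$. The pathwise Itô integral is $$\int_0^t\xi_s\,dS_s=\lim_{N\to\infty}\sum_{t_i,t_{i+1}\in\mathbb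 T_N,\;t_{i+1}\le t}\xi_{t_i}(S_{t_{i+1}}-S_{t_i}).$$ A pair $(\xi,\eta)$ of real-valued measurable functions on $[0,\infty)$ is a *self-financing strategy* if $\xi$ is an admissible integrand for $S$, $\int_0^t|\eta_sr_s|\,ds<\infty$ for all $t\ge0$, and its portfolio value $V_t=\xi_tS_t+\eta_tB_t$ satisfies $V_t=V_0+\int_0^t\xi_s\,dS_s+\int_0^t\eta_s\,dB_s$ for all $t\ge0$ (where $dB_s=r_sB_s\,ds$). Theorem. Let $\alpha\in[0,1]$ and $V_0\ge0$, and let $m$ be an admissible integrand for $S$. Then $m_t/S_t$ is an admissible integrand for $S$, and all integrals in the following definition exist. Define, for $t\ge0$, $$C_t=(1-\alpha)V_0\exp\Big(\int_0^t\frac{m_s}{S_s}\,dS_s-\frac12\int_0^t\frac{m_s^2}{S_s^2}\,d[S]_s+\int_0^t(1-m_s)r_s\,ds\Big),\qquad V_t=C_t+\alpha V_0B_t,$$ $$\xi_t=\frac{m_tC_t}{S_t},\qquad \eta_t=\frac{V_t-m_tC_t}{B_t}.$$ Then $(\xi,\eta)$ is a self-financing strategy with portfolio value $V$ (in particular with initial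 value $V_0$). It has no gap risk: $C_t\ge0$, i.e. $V_t\ge\alpha V_0B_t$, for all $t\ge0$. Moreover, it is the unique self-financing strategy with initial portfolio value $V_0$ that satisfies the feedback relations: if $(\tilde\xi,\tilde\eta)$ is a self-financing strategy whose portfolio value $\tilde V$ satisfies $\tilde V_0=V_0$ and, with $\tilde C_t=\tilde V_t-\alpha V_0B_t$, one has $\tilde\xi_t=m_t\tilde C_t/S_t$ and $\tilde\eta_t=(\tilde V_t-m_t\tilde C_t)/B_t$ for all $t\ge0$, then $\tilde\xi_t=\xi_t$ and $\tilde\eta_t=\eta_t$ for all $t\ge0$. -/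

import Mathlib

open Set Filter MeasureTheory
open scoped Topology

namespace PathwiseIto

/-! ### Time grids and pathwise sums

The time axis `[0,∞)` is `Set.Ici (0 : ℝ)`; paths are functions on `ℝ` of which only the values on
`[0,∞)` are ever used. -/

/-- A time grid `0 = t₀ < t₁ < ⋯` with `tₙ → ∞`. -/
structure TimeGrid where
  /-- the `i`-th grid point -/
  pt : ℕ → ℝ
  pt_zero : pt 0 = 0
  strictMono : StrictMono pt
  tendsto_pt : Tendsto pt atTop atTop

/-- A nested sequence of time grids `𝕋₀ ⊆ 𝕋₁ ⊆ ⋯` whose mesh `supᵢ (tᵢ₊₁ - tᵢ)` tends to `0`. -/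
structure GridSeq where
  /-- the `N`-th time grid -/
  grid : ℕ → TimeGrid
  nested : ∀ N, range (grid N).pt ⊆ range (grid (N + 1)).pt
  mesh_tendsto : ∀ ε : ℝ, 0 < ε → ∀ᶠ N in atTop, ∀ i,
    (grid N).pt (i + 1) - (grid N).pt i ≤ ε

lemma TimeGrid.finite_le (G : TimeGrid) (t : ℝ) : {i : ℕ | G.pt (i + 1) ≤ t}.Finite := by
  obtain ⟨n, hn⟩ := (G.tendsto_pt.eventually_gt_atTop t).exists
  refine (finite_Iio n).subset fun i hi => ?_
  by_contra h
  have h1 : G.pt n ≤ G.pt (i + 1) :=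
    G.strictMono.monotone (le_trans (not_lt.1 h) (Nat.le_succ i))
  exact absurd (h1.trans hi) (not_le.2 hn)

/-- The indices `i` of the grid intervals `[tᵢ, tᵢ₊₁]` with `tᵢ₊₁ ≤ t`. -/
noncomputable def TimeGrid.upTo (G : TimeGrid) (t : ℝ) : Finset ℕ := (G.finite_le t).toFinset

@[simp] lemma TimeGrid.mem_upTo (G : TimeGrid) (t : ℝ) (i : ℕ) :
    i ∈ G.upTo t ↔ G.pt (i + 1) ≤ t := by
  simp [TimeGrid.upTo]

/-- `∑_{tᵢ₊₁ ≤ t} (X(tᵢ₊₁) - X(tᵢ))²`. -/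
noncomputable def qvSum (G : TimeGrid) (X : ℝ → ℝ) (t : ℝ) : ℝ :=
  ∑ i ∈ G.upTo t, (X (G.pt (i + 1)) - X (G.pt i)) ^ 2

/-- The nonanticipative Riemann sum `∑_{tᵢ₊₁ ≤ t} ξ(tᵢ) (X(tᵢ₊₁) - X(tᵢ))`. -/
noncomputable def itoSum (G : TimeGrid) (X ξ : ℝ → ℝ) (t : ℝ) : ℝ :=
  ∑ i ∈ G.upTo t, ξ (G.pt i) * (X (G.pt (i + 1)) - X (G.pt i))

/-! ### Quadratic variation and the measure `d[X]` -/

/-- `X` has the continuous quadratic variation `Q = [X]` along the sequence of grids `T`. -/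
structure HasContinuousQV (T : GridSeq) (X Q : ℝ → ℝ) : Prop where
  zero : Q 0 = 0
  continuousOn : ContinuousOn Q (Ici 0)
  tendsto : ∀ t : ℝ, 0 < t → Tendsto (fun N => qvSum (T.grid N) X t) atTop (𝓝 (Q t))

lemma HasContinuousQV.monotoneOn {T : GridSeq} {X Q : ℝ → ℝ} (h : HasContinuousQV T X Q) :
    MonotoneOn Q (Ici 0) := by
  intro s hs t _ hst
  rcases (mem_Ici.1 hs).eq_or_lt with rfl | hs0
  · rcases hst.eq_or_lt with rfl | ht
    · exact le_rfl
    · rw [h.zero]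
      exact ge_of_tendsto' (h.tendsto t ht) fun N => Finset.sum_nonneg fun i _ => sq_nonneg _
  · refine le_of_tendsto_of_tendsto' (h.tendsto s hs0) (h.tendsto t (hs0.trans_le hst)) fun N => ?_
    refine Finset.sum_le_sum_of_subset_of_nonneg (fun i hi => ?_) fun i _ _ => sq_nonneg _
    rw [TimeGrid.mem_upTo] at hi ⊢
    exact hi.trans hst

/-- The quadratic variation as a Stieltjes function on `ℝ` (equal to `[X]` on `[0,∞)` and to `0` on
the negative half-line). -/
noncomputable def HasContinuousQV.stieltjes {T : GridSeq} {X Q : ℝ → ℝ}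
    (h : HasContinuousQV T X Q) : StieltjesFunction ℝ where
  toFun t := Q (max t 0)
  mono' := fun _ _ hst => h.monotoneOn (mem_Ici.2 (le_max_right _ _)) (mem_Ici.2 (le_max_right _ _))
    (max_le_max_right 0 hst)
  right_continuous' := fun _ => (h.continuousOn.comp_continuous
    (continuous_id.max continuous_const) fun _ => mem_Ici.2 (le_max_right _ _)).continuousWithinAt

/-- The Lebesgue–Stieltjes measure `d[X]`. -/
noncomputable def HasContinuousQV.measure {T : GridSeq} {X Q : ℝ → ℝ}
    (h : HasContinuousQV T X Q) : Measure ℝ := h.stieltjes.measure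

/-! ### Admissible integrands and the pathwise Itô integral -/

/-- `ξ` is an admissible integrand for `X`: for every `T > 0` it is on `[0,T]` of the form
`ξ t = g (A t, X t)`, where `g` is a `C¹` function on `ℝⁿ × ℝ` and `A : [0,∞) → ℝⁿ` is continuous
with components of finite variation on `[0,T]`. -/
def Admissible (X ξ : ℝ → ℝ) : Prop :=
  ∀ T : ℝ, 0 < T → ∃ (n : ℕ) (g : (Fin n → ℝ) × ℝ → ℝ) (A : ℝ → Fin n → ℝ),
    ContDiff ℝ 1 g ∧ ContinuousOn A (Ici 0) ∧
    (∀ k, BoundedVariationOn (fun t => A t k) (Icc 0 T)) ∧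
    ∀ t ∈ Icc (0 : ℝ) T, ξ t = g (A t, X t)

/-- The pathwise Itô integral `∫₀ᵗ ξ dX` exists along the sequence of grids and equals `I`. -/
def HasItoIntegral (T : GridSeq) (X ξ : ℝ → ℝ) (t I : ℝ) : Prop :=
  Tendsto (fun N => itoSum (T.grid N) X ξ t) atTop (𝓝 I)

/-- The pathwise Itô integral `∫₀ᵗ ξ dX` (meaningful if the limit exists). -/
noncomputable def itoIntegral (T : GridSeq) (X ξ : ℝ → ℝ) (t : ℝ) : ℝ :=
  limUnder atTop (fun N => itoSum (T.grid N) X ξ t)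

/-! ### The market, self-financing strategies and DPPI -/

/-- The bond price `B t = exp (∫₀ᵗ r s ds)`. -/
noncomputable def bond (r : ℝ → ℝ) (t : ℝ) : ℝ := Real.exp (∫ s in (0 : ℝ)..t, r s)

/-- The bond price is the indefinite integral of its density `r B`, i.e. `dB = r B ds`. -/
lemma integral_mul_bond {r : ℝ → ℝ} (hr : ∀ t : ℝ, 0 < t → IntegrableOn r (Icc 0 t)) {a b : ℝ}
    (ha : 0 ≤ a) (hab : a ≤ b) :
    ∫ s in a..b, r s * bond r s = bond r b - bond r a := by
  have h0b : (0 : ℝ) ≤ b := ha.trans hab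
  have hint : IntervalIntegrable r volume 0 b :=
    (intervalIntegrable_iff_integrableOn_Icc_of_le h0b).2
      ((hr (b + 1) (by linarith)).mono_set (Icc_subset_Icc_right (by linarith)))
  set F : ℝ → ℝ := fun x => ∫ s in (0 : ℝ)..x, r s with hF
  have hFac : AbsolutelyContinuousOnInterval F 0 b :=
    hint.absolutelyContinuousOnInterval_intervalIntegral (by simp)
  obtain ⟨M, hM⟩ := hFac.exists_bound
  have hLip : ∀ x ∈ uIcc 0 b, ∀ y ∈ uIcc 0 b,
      dist (bond r x) (bond r y) ≤ Real.exp M * dist (F x) (F y) := by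
    intro x hx y hy
    have h := (convex_Iic M).norm_image_sub_le_of_norm_deriv_le (f := Real.exp)
      (C := Real.exp M) (fun z _ => Real.differentiableAt_exp)
      (fun z hz => by
        rw [Real.deriv_exp, Real.norm_eq_abs, abs_of_pos (Real.exp_pos z)]
        exact Real.exp_le_exp.2 hz)
      (show F y ∈ Iic M from (le_abs_self _).trans (hM y hy))
      (show F x ∈ Iic M from (le_abs_self _).trans (hM x hx))
    rw [dist_eq_norm, dist_eq_norm]
    exact h
  have hBac : AbsolutelyContinuousOnInterval (bond r) 0 b := by
    rw [absolutelyContinuousOnInterval_iff] at hFac ⊢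
    intro ε hε
    obtain ⟨δ, hδ, H⟩ := hFac (ε / Real.exp M) (div_pos hε (Real.exp_pos M))
    refine ⟨δ, hδ, fun E hE hEδ => ?_⟩
    have h1 := H E hE hEδ
    rw [lt_div_iff₀' (Real.exp_pos M), Finset.mul_sum] at h1
    refine lt_of_le_of_lt (Finset.sum_le_sum fun i hi => ?_) h1
    have h2 := hE.1 i hi
    exact hLip _ h2.1 _ h2.2
  have hsub : uIcc a b ⊆ uIcc 0 b := by
    rw [uIcc_of_le hab, uIcc_of_le h0b]
    exact Icc_subset_Icc_left ha
  rw [← (hBac.mono hsub).integral_deriv_eq_sub]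
  refine intervalIntegral.integral_congr_ae ?_
  filter_upwards [hint.ae_hasDerivAt_integral] with x hx hxab
  have hd := (hx (hsub (uIoc_subset_uIcc hxab)) 0 (by simp)).exp
  rw [show deriv (bond r) x = _ from hd.deriv]
  exact mul_comm _ _

/-- The Stieltjes integral `∫₀ᵗ η dB`; since `dB = r B ds`, it is the Lebesgue integral
`∫₀ᵗ η r B ds`. -/
noncomputable def bondIntegral (r η : ℝ → ℝ) (t : ℝ) : ℝ :=
  ∫ s in (0 : ℝ)..t, η s * (r s * bond r s)

/-- The portfolio value `V = ξ S + η B`. -/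
noncomputable def portfolioValue (r S ξ η : ℝ → ℝ) (t : ℝ) : ℝ := ξ t * S t + η t * bond r t

/-- `(ξ, η)` is a self-financing strategy: both functions are measurable on `[0,∞)`, `ξ` is an
admissible integrand for `S`, `η r` is integrable on bounded intervals, and
`V t = V 0 + ∫₀ᵗ ξ dS + ∫₀ᵗ η dB` for all `t ≥ 0`. -/
structure SelfFinancing (T : GridSeq) (r S ξ η : ℝ → ℝ) : Prop where
  measurable_stock : Measurable (fun t : Ici (0 : ℝ) => ξ t)
  measurable_bond : Measurable (fun t : Ici (0 : ℝ) => η t)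
  admissible : Admissible S ξ
  integrable : ∀ t : ℝ, 0 ≤ t → IntegrableOn (fun s => η s * r s) (Icc 0 t)
  value_eq : ∀ t : ℝ, 0 ≤ t → ∃ I : ℝ, HasItoIntegral T S ξ t I ∧
    portfolioValue r S ξ η t = portfolioValue r S ξ η 0 + I + bondIntegral r η t

/-- `(ξ, η)` starts from the capital `V₀` and follows the DPPI feedback rule: with the portfolio
value `V` and the cushion `C = V - α V₀ B`, one has `ξ = m C / S` and `η = (V - m C) / B`. -/
structure IsDPPI (r S m : ℝ → ℝ) (α V₀ : ℝ) (ξ η : ℝ → ℝ) : Prop where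
  initial : portfolioValue r S ξ η 0 = V₀
  stock : ∀ t : ℝ, 0 ≤ t →
    ξ t = m t * (portfolioValue r S ξ η t - α * V₀ * bond r t) / S t
  bond : ∀ t : ℝ, 0 ≤ t →
    η t = (portfolioValue r S ξ η t
      - m t * (portfolioValue r S ξ η t - α * V₀ * bond r t)) / bond r t

/-- The cushion
`C t = (1-α) V₀ exp (∫₀ᵗ (m/S) dS - ½ ∫₀ᵗ (m²/S²) d[S] + ∫₀ᵗ (1-m) r ds)`, where `ν = d[S]`. -/
noncomputable def dppiCushion (T : GridSeq) (r S : ℝ → ℝ) (ν : Measure ℝ) (m : ℝ → ℝ)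
    (α V₀ t : ℝ) : ℝ :=
  (1 - α) * V₀ * Real.exp (itoIntegral T S (fun s => m s / S s) t
    - 1 / 2 * (∫ s in Ioc 0 t, m s ^ 2 / S s ^ 2 ∂ν)
    + ∫ s in (0 : ℝ)..t, (1 - m s) * r s)

end PathwiseIto

open PathwiseIto

/-! ### Sums over grid intervals, and arrays of bounded or vanishing mass. -/

namespace PathwiseIto

/-! The cushion must solve the linear equation `dC = C ((m/S) dS + (1-m) r dt)`. Its solution is the
stochastic exponential in the definition: in Itô's formula for the exponential, the second order
term `½ (m/S)² d[S]` cancels the correction `-½ (m²/S²) d[S]`. Adding the floor `α V₀ B` gives the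
self-financing equation, and positivity of the exponential excludes gap risk. For uniqueness, the
cushion `C'` of a competing strategy solves the same linear equation; the product rule shows that
`C' e^{-L}`, where `L` is the exponent, has vanishing dynamics. It is therefore constant, and the
initial value forces `C' = C`.

Itô calculus is carried out on arrays `p N i` indexed by grid and interval. `ItoProcess` says that
`dX = h dS + κ dQ + ρ dΛ` holds up to a `Null` array, without asking for the individual sums to
converge. The decisive fact is `GridSeq.Null.left_mul`: null arrays of bounded mass remain null
under continuous weights. From it follow the product rule `ItoProcess.mul` and the exponential
formula `ItoProcess.exp`.

Itô integrals exist by `exists_itoProcess`: with `f` an antiderivative of `g` in the price variable,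
`f(A,S)` minus a continuous finite variation path has dynamics `g(A,S) dS`. Hence the integral of an
admissible integrand is again locally a `C¹` function of `S` and finite variation paths
(`Admissible.itoIntegral`), which makes `ξ = m C / S` admissible. -/

lemma TimeGrid.pt_nonneg (G : TimeGrid) (i : ℕ) : 0 ≤ G.pt i := by
  rw [← G.pt_zero]; exact G.strictMono.monotone (Nat.zero_le i)

lemma TimeGrid.pt_le_pt_succ (G : TimeGrid) (i : ℕ) : G.pt i ≤ G.pt (i + 1) :=
  G.strictMono.monotone (Nat.le_succ i)

lemma TimeGrid.upTo_mono (G : TimeGrid) {s t : ℝ} (hst : s ≤ t) : G.upTo s ⊆ G.upTo t := by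
  intro i hi
  rw [TimeGrid.mem_upTo] at hi ⊢
  exact hi.trans hst

lemma TimeGrid.exists_upTo_eq_range (G : TimeGrid) {t : ℝ} (ht : 0 ≤ t) :
    ∃ n, G.upTo t = Finset.range n ∧ G.pt n ≤ t ∧ t < G.pt (n + 1) := by
  classical
  have hex : ∃ n, t < G.pt (n + 1) := by
    obtain ⟨n, hn⟩ := (G.tendsto_pt.eventually_gt_atTop t).exists
    exact ⟨n, hn.trans_le (G.pt_le_pt_succ n)⟩
  refine ⟨Nat.find hex, ?_, ?_, Nat.find_spec hex⟩
  · ext i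
    rw [TimeGrid.mem_upTo, Finset.mem_range]
    refine ⟨fun h => ?_, fun h => not_lt.1 (Nat.find_min hex h)⟩
    by_contra hlt
    exact absurd ((Nat.find_spec hex).trans_le
      (G.strictMono.monotone (Nat.succ_le_succ (not_lt.1 hlt)))) (not_lt.2 h)
  · rcases hn : Nat.find hex with _ | k
    · rwa [G.pt_zero]
    · exact not_lt.1 (Nat.find_min hex (m := k) (by omega))

namespace GridSeq

/-- The increment `X(tᵢ₊₁) - X(tᵢ)` over the `i`-th interval of the `N`-th grid. -/
def inc (T : GridSeq) (X : ℝ → ℝ) (N i : ℕ) : ℝ :=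
  X ((T.grid N).pt (i + 1)) - X ((T.grid N).pt i)

/-- The value `X(tᵢ)` at the left end point of the `i`-th interval of the `N`-th grid. -/
def left (T : GridSeq) (X : ℝ → ℝ) (N i : ℕ) : ℝ := X ((T.grid N).pt i)

/-- The sum of `p N i` over the intervals `[tᵢ, tᵢ₊₁]` of the `N`-th grid with `tᵢ₊₁ ≤ t`. -/
noncomputable def psum (T : GridSeq) (p : ℕ → ℕ → ℝ) (t : ℝ) (N : ℕ) : ℝ :=
  ∑ i ∈ (T.grid N).upTo t, p N i

lemma psum_add (T : GridSeq) (p q : ℕ → ℕ → ℝ) (t : ℝ) :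
    T.psum (p + q) t = fun N => T.psum p t N + T.psum q t N := by
  funext N; simp [psum, Finset.sum_add_distrib]

lemma psum_sub (T : GridSeq) (p q : ℕ → ℕ → ℝ) (t : ℝ) :
    T.psum (p - q) t = fun N => T.psum p t N - T.psum q t N := by
  funext N; simp [psum, Finset.sum_sub_distrib]

lemma psum_mono (T : GridSeq) {p q : ℕ → ℕ → ℝ} {t : ℝ} {N : ℕ}
    (h : ∀ i ∈ (T.grid N).upTo t, p N i ≤ q N i) : T.psum p t N ≤ T.psum q t N :=
  Finset.sum_le_sum h

lemma abs_psum_le (T : GridSeq) (p : ℕ → ℕ → ℝ) (t : ℝ) (N : ℕ) :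
    |T.psum p t N| ≤ T.psum (fun N i => |p N i|) t N :=
  Finset.abs_sum_le_sum_abs _ _

lemma psum_const_mul (T : GridSeq) (c : ℝ) (p : ℕ → ℕ → ℝ) (t : ℝ) (N : ℕ) :
    T.psum (fun N i => c * p N i) t N = c * T.psum p t N := by
  simp [psum, Finset.mul_sum]

lemma psum_abs_nonneg (T : GridSeq) (p : ℕ → ℕ → ℝ) (t : ℝ) (N : ℕ) :
    0 ≤ T.psum (fun N i => |p N i|) t N := Finset.sum_nonneg fun _ _ => abs_nonneg _

lemma psum_sub_psum (T : GridSeq) (p : ℕ → ℕ → ℝ) {s t : ℝ} (hst : s ≤ t) (N : ℕ) :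
    T.psum p t N - T.psum p s N =
      ∑ i ∈ (T.grid N).upTo t \ (T.grid N).upTo s, p N i := by
  rw [psum, psum, ← Finset.sum_sdiff ((T.grid N).upTo_mono hst)]; ring

lemma psum_zero (T : GridSeq) (p : ℕ → ℕ → ℝ) (N : ℕ) : T.psum p 0 N = 0 := by
  have : (T.grid N).upTo 0 = ∅ := by
    refine Finset.eq_empty_of_forall_notMem fun i hi => ?_
    rw [TimeGrid.mem_upTo] at hi
    exact absurd ((T.grid N).strictMono (Nat.succ_pos i))
      (not_lt.2 (by rw [(T.grid N).pt_zero]; exact hi))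
  simp [psum, this]

lemma psum_zero_array (T : GridSeq) (t : ℝ) : T.psum (fun _ _ => 0) t = fun _ => 0 := by
  funext N; simp [psum]

/-- The sum telescopes to the value at the last grid point not exceeding `t`, and that point tends
to `t` because the mesh vanishes. -/
lemma tendsto_psum_inc (T : GridSeq) {X : ℝ → ℝ} {t : ℝ} (ht : 0 ≤ t)
    (hX : ContinuousOn X (Icc 0 t)) :
    Tendsto (T.psum (T.inc X) t) atTop (𝓝 (X t - X 0)) := by
  choose n hn hn1 hn2 using fun N => (T.grid N).exists_upTo_eq_range ht
  have h1 : T.psum (T.inc X) t = fun N => X ((T.grid N).pt (n N)) - X 0 := by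
    funext N
    simp only [psum, inc, hn N]
    rw [Finset.sum_range_sub (fun i => X ((T.grid N).pt i)), (T.grid N).pt_zero]
  rw [h1]
  refine Tendsto.sub_const ?_ _
  have h2 : Tendsto (fun N => (T.grid N).pt (n N)) atTop (𝓝 t) := by
    rw [Metric.tendsto_atTop']
    intro ε hε
    obtain ⟨M, hM⟩ := eventually_atTop.1 (T.mesh_tendsto (ε / 2) (by positivity))
    refine ⟨M, fun N hN => ?_⟩
    have := hM N hN.le (n N)
    have a := hn1 N
    have b := hn2 N
    rw [Real.dist_eq, abs_lt]
    constructor <;> linarith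
  have h3 := hX t (right_mem_Icc.2 ht)
  exact h3.tendsto.comp (tendsto_nhdsWithin_iff.2
    ⟨h2, Eventually.of_forall fun N => ⟨(T.grid N).pt_nonneg _, hn1 N⟩⟩)

lemma pt_mem_of_mem_upTo (T : GridSeq) {t : ℝ} {N i : ℕ} (hi : i ∈ (T.grid N).upTo t) :
    (T.grid N).pt i ∈ Icc 0 t ∧ (T.grid N).pt (i + 1) ∈ Icc 0 t := by
  rw [TimeGrid.mem_upTo] at hi
  exact ⟨⟨(T.grid N).pt_nonneg _, ((T.grid N).pt_le_pt_succ i).trans hi⟩,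
    (T.grid N).pt_nonneg _, hi⟩

/-- Uniform continuity along the grids. -/
lemma eventually_osc_le (T : GridSeq) {E : Type*} [PseudoMetricSpace E] {X : ℝ → E} {t : ℝ}
    (hX : ContinuousOn X (Icc 0 t)) {ε : ℝ} (hε : 0 < ε) :
    ∀ᶠ N in atTop, ∀ i ∈ (T.grid N).upTo t,
      ∀ u ∈ Icc ((T.grid N).pt i) ((T.grid N).pt (i + 1)),
        dist (X u) (X ((T.grid N).pt i)) ≤ ε := by
  have huc := isCompact_Icc.uniformContinuousOn_of_continuous hX
  rw [Metric.uniformContinuousOn_iff] at huc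
  obtain ⟨δ, hδ, H⟩ := huc ε hε
  filter_upwards [T.mesh_tendsto (δ / 2) (by positivity)] with N hN i hi u hu
  obtain ⟨h1, h2⟩ := T.pt_mem_of_mem_upTo hi
  refine (H u ⟨h1.1.trans hu.1, hu.2.trans h2.2⟩ _ h1 ?_).le
  rw [Real.dist_eq, abs_of_nonneg (by linarith [hu.1])]
  linarith [hN i, hu.2]

lemma eventually_abs_inc_le (T : GridSeq) {X : ℝ → ℝ} {t : ℝ}
    (hX : ContinuousOn X (Icc 0 t)) {ε : ℝ} (hε : 0 < ε) :
    ∀ᶠ N in atTop, ∀ i ∈ (T.grid N).upTo t, |T.inc X N i| ≤ ε := by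
  filter_upwards [T.eventually_osc_le hX hε] with N hN i hi
  simpa [Real.dist_eq, inc] using hN i hi _ (right_mem_Icc.2 ((T.grid N).pt_le_pt_succ i))

/-- The total absolute mass of `p` on `[0,t]` is bounded along the grids, for every `t`. -/
def Bdd (T : GridSeq) (p : ℕ → ℕ → ℝ) : Prop :=
  ∀ t : ℝ, 0 ≤ t → ∃ K, ∀ᶠ N in atTop, T.psum (fun N i => |p N i|) t N ≤ K

/-- The total absolute mass of `p` on `[0,t]` tends to zero along the grids, for every `t`. -/
def StrongNull (T : GridSeq) (p : ℕ → ℕ → ℝ) : Prop :=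
  ∀ t : ℝ, 0 ≤ t → Tendsto (T.psum (fun N i => |p N i|) t) atTop (𝓝 0)

/-- `p` is bounded in total mass and its sums over `[0,t]` tend to zero, for every `t`. -/
structure Null (T : GridSeq) (p : ℕ → ℕ → ℝ) : Prop where
  bdd : T.Bdd p
  tendsto : ∀ t : ℝ, 0 ≤ t → Tendsto (T.psum p t) atTop (𝓝 0)

lemma Bdd.add {T : GridSeq} {p q : ℕ → ℕ → ℝ} (hp : T.Bdd p) (hq : T.Bdd q) :
    T.Bdd (p + q) := by
  intro t ht
  obtain ⟨K, hK⟩ := hp t ht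
  obtain ⟨L, hL⟩ := hq t ht
  refine ⟨K + L, ?_⟩
  filter_upwards [hK, hL] with N h1 h2
  refine le_trans ?_ (add_le_add h1 h2)
  rw [psum, psum, psum, ← Finset.sum_add_distrib]
  exact Finset.sum_le_sum fun i _ => abs_add_le _ _

lemma Bdd.neg {T : GridSeq} {p : ℕ → ℕ → ℝ} (hp : T.Bdd p) : T.Bdd (-p) := by
  simpa [Bdd] using hp

lemma Bdd.sub {T : GridSeq} {p q : ℕ → ℕ → ℝ} (hp : T.Bdd p) (hq : T.Bdd q) :
    T.Bdd (p - q) := by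
  rw [sub_eq_add_neg]; exact hp.add hq.neg

lemma exists_left_le (T : GridSeq) {Y : ℝ → ℝ} (hY : ContinuousOn Y (Ici 0)) (t : ℝ) :
    ∃ C, 0 < C ∧ ∀ N, ∀ i ∈ (T.grid N).upTo t, |T.left Y N i| ≤ C := by
  obtain ⟨C, hC⟩ := isCompact_Icc.exists_bound_of_continuousOn
    (hY.mono (Icc_subset_Ici_self : Icc 0 t ⊆ Ici 0))
  exact ⟨max C 1, by positivity, fun N i hi =>
    (hC _ (T.pt_mem_of_mem_upTo hi).1).trans (le_max_left _ _)⟩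

lemma Bdd.left_mul {T : GridSeq} {p : ℕ → ℕ → ℝ} (hp : T.Bdd p) {Y : ℝ → ℝ}
    (hY : ContinuousOn Y (Ici 0)) : T.Bdd (T.left Y * p) := by
  intro t ht
  obtain ⟨K, hK⟩ := hp t ht
  obtain ⟨C, hC0, hC⟩ := T.exists_left_le hY t
  refine ⟨C * K, ?_⟩
  filter_upwards [hK] with N h1
  refine le_trans ?_ (mul_le_mul_of_nonneg_left h1 hC0.le)
  rw [← psum_const_mul]
  refine T.psum_mono fun i hi => ?_
  simp only [Pi.mul_apply, abs_mul]
  exact mul_le_mul_of_nonneg_right (hC N i hi) (abs_nonneg _)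

lemma StrongNull.null {T : GridSeq} {p : ℕ → ℕ → ℝ} (hp : T.StrongNull p) : T.Null p where
  bdd t ht := ⟨1, (hp t ht).eventually_le_const zero_lt_one⟩
  tendsto t ht := squeeze_zero_norm (fun N => T.abs_psum_le p t N) (hp t ht)

/-- A criterion for negligibility: `p` is eventually dominated by arbitrarily small multiples of
something of bounded mass. -/
lemma strongNull_of_le {T : GridSeq} {p a : ℕ → ℕ → ℝ} (ha : T.Bdd a)
    (h : ∀ t : ℝ, 0 ≤ t → ∀ ε : ℝ, 0 < ε → ∀ᶠ N in atTop, ∀ i ∈ (T.grid N).upTo t,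
      |p N i| ≤ ε * |a N i|) : T.StrongNull p := by
  intro t ht
  obtain ⟨K, hK⟩ := ha t ht
  rw [Metric.tendsto_nhds]
  intro ε hε
  have hK1 : 0 < |K| + 1 := by positivity
  filter_upwards [hK, h t ht (ε / 2 / (|K| + 1)) (by positivity)] with N h1 h2
  rw [Real.dist_eq, sub_zero, abs_of_nonneg (T.psum_abs_nonneg _ _ _)]
  calc T.psum (fun N i => |p N i|) t N
      ≤ T.psum (fun N i => ε / 2 / (|K| + 1) * |a N i|) t N := T.psum_mono h2
    _ = ε / 2 / (|K| + 1) * T.psum (fun N i => |a N i|) t N := T.psum_const_mul _ _ _ _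
    _ ≤ ε / 2 / (|K| + 1) * (|K| + 1) :=
        mul_le_mul_of_nonneg_left (by linarith [le_abs_self K]) (by positivity)
    _ = ε / 2 := by field_simp
    _ < ε := by linarith

/-- Increments of a continuous path are uniformly small on `[0,t]`, so they turn bounded mass into
vanishing mass. This disposes of every cross term in the product rule. -/
lemma StrongNull.inc_mul {T : GridSeq} {a : ℕ → ℕ → ℝ} (ha : T.Bdd a) {X : ℝ → ℝ}
    (hX : ContinuousOn X (Ici 0)) : T.StrongNull (T.inc X * a) := by
  refine strongNull_of_le ha fun t _ ε hε => ?_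
  filter_upwards [T.eventually_abs_inc_le (hX.mono Icc_subset_Ici_self) hε] with N hN i hi
  rw [Pi.mul_apply, Pi.mul_apply, abs_mul]
  exact mul_le_mul_of_nonneg_right (hN i hi) (abs_nonneg _)

lemma StrongNull.left_mul {T : GridSeq} {p : ℕ → ℕ → ℝ} (hp : T.StrongNull p) {Y : ℝ → ℝ}
    (hY : ContinuousOn Y (Ici 0)) : T.StrongNull (T.left Y * p) := by
  intro t ht
  obtain ⟨C, hC0, hC⟩ := T.exists_left_le hY t
  have h := (hp t ht).const_mul C
  rw [mul_zero] at h
  refine squeeze_zero (fun N => T.psum_abs_nonneg _ _ _) (fun N => ?_) h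
  rw [← psum_const_mul]
  refine T.psum_mono fun i hi => ?_
  simp only [Pi.mul_apply, abs_mul]
  exact mul_le_mul_of_nonneg_right (hC N i hi) (abs_nonneg _)

/-- Weighted sums are, up to `ε` times the total mass, close to a constant. -/
lemma exists_eventually_abs_psum_left_mul_le {T : GridSeq} {p : ℕ → ℕ → ℝ} {P Y : ℝ → ℝ}
    (hP : ∀ s : ℝ, 0 ≤ s → Tendsto (T.psum p s) atTop (𝓝 (P s)))
    (hY : ContinuousOn Y (Ici 0)) {t ε : ℝ} (ht : 0 ≤ t) (hε : 0 < ε) :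
    ∃ c, ((∀ s : ℝ, 0 ≤ s → P s = 0) → c = 0) ∧ ∀ η : ℝ, 0 < η → ∀ᶠ N in atTop,
      |T.psum (T.left Y * p) t N - c| ≤ ε * T.psum (fun N i => |p N i|) t N + η := by
  have huc := isCompact_Icc.uniformContinuousOn_of_continuous
    (hY.mono (Icc_subset_Ici_self : Icc 0 t ⊆ Ici 0))
  rw [Metric.uniformContinuousOn_iff] at huc
  obtain ⟨δ, hδ, H⟩ := huc ε hε
  -- The interval is cut into blocks of length at most `δ/2`. On each block the weight is frozen at
  -- the left end of the block, at a cost of `ε` times the mass there; the induction adds one block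
  -- at a time.
  suffices key : ∀ k : ℕ, ∀ s : ℝ, 0 ≤ s → s ≤ t → s ≤ k * (δ / 2) →
      ∃ c, ((∀ s : ℝ, 0 ≤ s → P s = 0) → c = 0) ∧ ∀ η : ℝ, 0 < η → ∀ᶠ N in atTop,
      |T.psum (T.left Y * p) s N - c| ≤ ε * T.psum (fun N i => |p N i|) s N + η by
    obtain ⟨k, hk⟩ := exists_nat_ge (t / (δ / 2))
    exact key k t ht le_rfl ((div_le_iff₀ (by positivity)).1 hk)
  intro k
  induction k with
  | zero =>
    intro s hs _ hs0
    refine ⟨0, fun _ => rfl, fun η hη => Eventually.of_forall fun N => ?_⟩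
    obtain rfl : s = 0 := le_antisymm (by simpa using hs0) hs
    simp [psum_zero, hη.le]
  | succ k ih =>
    intro s hs hst hsk
    set u := max 0 (s - δ / 2) with hu
    have hu0 : 0 ≤ u := le_max_left _ _
    have hus : u ≤ s := max_le hs (by linarith)
    have hsu : s ≤ u + δ / 2 := by linarith [le_max_right 0 (s - δ / 2)]
    obtain ⟨c, hc0, hc⟩ := ih u hu0 (hus.trans hst)
      (max_le (by positivity) (by push_cast at hsk; linarith))
    -- The constant is a Riemann sum for `∫ Y dP` over the blocks, so it vanishes when `P` does.
    refine ⟨c + Y u * (P s - P u), fun h0 => by simp [hc0 h0, h0 s hs, h0 u hu0],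
      fun η hη => ?_⟩
    have h1 := (((hP s hs).sub (hP u hu0)).const_mul (Y u)).eventually
      (Metric.closedBall_mem_nhds _ (half_pos hη))
    filter_upwards [hc (η / 2) (half_pos hη), h1, T.mesh_tendsto (δ / 4) (by positivity)]
      with N hN1 hN2 hN3
    rw [Real.dist_eq] at hN2
    have e1 := T.psum_sub_psum (T.left Y * p) hus N
    have e2 := T.psum_sub_psum p hus N
    have e3 := T.psum_sub_psum (fun N i => |p N i|) hus N
    have h2 : |(T.psum (T.left Y * p) s N - T.psum (T.left Y * p) u N)
        - Y u * (T.psum p s N - T.psum p u N)|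
        ≤ ε * (T.psum (fun N i => |p N i|) s N - T.psum (fun N i => |p N i|) u N) := by
      rw [e1, e2, e3, Finset.mul_sum, Finset.mul_sum, ← Finset.sum_sub_distrib]
      refine (Finset.abs_sum_le_sum_abs _ _).trans (Finset.sum_le_sum fun i hi => ?_)
      rw [Finset.mem_sdiff, TimeGrid.mem_upTo, TimeGrid.mem_upTo, not_le] at hi
      simp only [Pi.mul_apply, left]
      rw [← sub_mul, abs_mul]
      refine mul_le_mul_of_nonneg_right ?_ (abs_nonneg _)
      have a1 := (T.grid N).pt_nonneg i
      have a2 := (T.grid N).pt_le_pt_succ i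
      have a3 := hN3 i
      -- An interval ending in `(u, s]` may begin before `u`, but by at most the mesh `δ/4`, so its
      -- left end is still within `δ` of `u`.
      refine (H _ ⟨a1, by linarith⟩ u ⟨hu0, hus.trans hst⟩ ?_).le
      rw [Real.dist_eq, abs_lt]
      constructor <;> linarith
    rw [abs_le] at *
    constructor <;> linarith

/-- For every `ε` the sums eventually stay within a multiple of `ε` of some constant, so they are
Cauchy. Stieltjes integrals are thus obtained as limits of Riemann sums, without a signed measure.
-/
lemma exists_tendsto_psum_left_mul {T : GridSeq} {p : ℕ → ℕ → ℝ} {P Y : ℝ → ℝ}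
    (hp : T.Bdd p) (hP : ∀ s : ℝ, 0 ≤ s → Tendsto (T.psum p s) atTop (𝓝 (P s)))
    (hY : ContinuousOn Y (Ici 0)) {t : ℝ} (ht : 0 ≤ t) :
    ∃ J, Tendsto (T.psum (T.left Y * p) t) atTop (𝓝 J) := by
  obtain ⟨K, hK⟩ := hp t ht
  refine cauchySeq_tendsto_of_complete (Metric.cauchySeq_iff'.2 fun ε hε => ?_)
  have hK1 : 0 < |K| + 1 := by positivity
  obtain ⟨c, -, hc⟩ := exists_eventually_abs_psum_left_mul_le hP hY ht
    (show 0 < ε / 8 / (|K| + 1) by positivity)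
  have h1 : ∀ᶠ N in atTop, |T.psum (T.left Y * p) t N - c| ≤ ε / 4 := by
    filter_upwards [hK, hc (ε / 8) (by positivity)] with N h1 h2
    have : ε / 8 / (|K| + 1) * T.psum (fun N i => |p N i|) t N ≤ ε / 8 := by
      calc _ ≤ ε / 8 / (|K| + 1) * (|K| + 1) :=
            mul_le_mul_of_nonneg_left (by linarith [le_abs_self K]) (by positivity)
        _ = ε / 8 := by field_simp
    linarith
  obtain ⟨M, hM⟩ := eventually_atTop.1 h1
  refine ⟨M, fun N hN => ?_⟩
  have a := hM N hN
  have b := hM M le_rfl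
  rw [Real.dist_eq, abs_lt]
  rw [abs_le] at a b
  constructor <;> linarith

/-- The sums of a null array remain null when weighted by a continuous function. -/
lemma Null.left_mul {T : GridSeq} {p : ℕ → ℕ → ℝ} (hp : T.Null p) {Y : ℝ → ℝ}
    (hY : ContinuousOn Y (Ici 0)) : T.Null (T.left Y * p) := by
  refine ⟨hp.bdd.left_mul hY, fun t ht => ?_⟩
  obtain ⟨K, hK⟩ := hp.bdd t ht
  rw [Metric.tendsto_nhds]
  intro ε hε
  have hK1 : 0 < |K| + 1 := by positivity
  obtain ⟨c, hc0, hc⟩ := exists_eventually_abs_psum_left_mul_le (P := fun _ => 0) hp.tendsto hY ht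
    (show 0 < ε / 4 / (|K| + 1) by positivity)
  obtain rfl := hc0 fun _ _ => rfl
  filter_upwards [hK, hc (ε / 4) (by positivity)] with N h1 h2
  have : ε / 4 / (|K| + 1) * T.psum (fun N i => |p N i|) t N ≤ ε / 4 := by
    calc _ ≤ ε / 4 / (|K| + 1) * (|K| + 1) :=
          mul_le_mul_of_nonneg_left (by linarith [le_abs_self K]) (by positivity)
      _ = ε / 4 := by field_simp
  rw [Real.dist_eq]
  linarith

lemma Null.add {T : GridSeq} {p q : ℕ → ℕ → ℝ} (hp : T.Null p) (hq : T.Null q) :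
    T.Null (p + q) where
  bdd := hp.bdd.add hq.bdd
  tendsto t ht := by
    rw [psum_add]; simpa using (hp.tendsto t ht).add (hq.tendsto t ht)

end GridSeq
end PathwiseIto

/-! ### Continuous paths of finite variation and convergent arrays. -/

namespace PathwiseIto

/-- `A` is continuous and of finite variation on every `[0,T]`: its increments are controlled by
those of a continuous function. -/
def ContFV (A : ℝ → ℝ) : Prop :=
  ∀ t : ℝ, 0 < t → ∃ v : ℝ → ℝ, ContinuousOn v (Icc 0 t) ∧
    ∀ a b : ℝ, 0 ≤ a → a ≤ b → b ≤ t → |A b - A a| ≤ v b - v a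

lemma ContFV.continuousOn {A : ℝ → ℝ} (hA : ContFV A) : ContinuousOn A (Ici 0) := by
  intro x hx
  rw [mem_Ici] at hx
  obtain ⟨v, hv, h⟩ := hA (x + 1) (by linarith)
  have hmem : Icc 0 (x + 1) ∈ 𝓝[Ici 0] x := by
    rw [← Ici_inter_Iic]
    exact inter_mem_nhdsWithin _ (Iic_mem_nhds (lt_add_one x))
  have h1 : ContinuousWithinAt v (Ici 0) x :=
    (hv x ⟨hx, by linarith⟩).mono_of_mem_nhdsWithin hmem
  have h2 : Tendsto (fun y => |v y - v x|) (𝓝[Ici 0] x) (𝓝 0) := by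
    simpa using (h1.sub (continuousWithinAt_const (b := v x))).abs.tendsto
  rw [ContinuousWithinAt, tendsto_iff_dist_tendsto_zero]
  refine squeeze_zero' (Eventually.of_forall fun _ => dist_nonneg) ?_ h2
  filter_upwards [hmem] with y hy
  rw [Real.dist_eq]
  rcases le_total x y with hxy | hxy
  · exact (h x y hx hxy hy.2).trans (le_abs_self _)
  · rw [abs_sub_comm, abs_sub_comm (v y)]
    exact (h y x hy.1 hxy (by linarith)).trans (le_abs_self _)

namespace GridSeq

/-- On every `[0,t]`, `p` is dominated by an array whose sums converge to a continuous function. -/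
def Dom (T : GridSeq) (p : ℕ → ℕ → ℝ) : Prop :=
  ∀ t : ℝ, 0 < t → ∃ (w : ℕ → ℕ → ℝ) (v : ℝ → ℝ), ContinuousOn v (Icc 0 t) ∧
    (∀ N, ∀ i ∈ (T.grid N).upTo t, |p N i| ≤ w N i) ∧
    ∀ s : ℝ, 0 ≤ s → s ≤ t → Tendsto (T.psum w s) atTop (𝓝 (v s))

lemma Dom.bdd {T : GridSeq} {p : ℕ → ℕ → ℝ} (hp : T.Dom p) : T.Bdd p := by
  intro t ht
  rcases ht.eq_or_lt with rfl | ht0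
  · exact ⟨0, Eventually.of_forall fun N => (T.psum_zero _ N).le⟩
  obtain ⟨w, v, -, hw, hv⟩ := hp t ht0
  refine ⟨v t + 1, ?_⟩
  filter_upwards [(hv t ht le_rfl).eventually_le_const (lt_add_one (v t))] with N hN
  exact (T.psum_mono (hw N)).trans hN

lemma Dom.left_mul {T : GridSeq} {p : ℕ → ℕ → ℝ} (hp : T.Dom p) {Y : ℝ → ℝ}
    (hY : ContinuousOn Y (Ici 0)) : T.Dom (T.left Y * p) := by
  intro t ht
  obtain ⟨w, v, hvc, hw, hv⟩ := hp t ht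
  obtain ⟨C, hC0, hC⟩ := T.exists_left_le hY t
  refine ⟨fun N i => C * w N i, fun s => C * v s, continuousOn_const.mul hvc,
    fun N i hi => ?_, fun s hs hst => ?_⟩
  · rw [Pi.mul_apply, Pi.mul_apply, abs_mul]
    exact mul_le_mul (hC N i hi) (hw N i hi) (abs_nonneg _) hC0.le
  · simp only [show T.psum (fun N i => C * w N i) s = fun N => C * T.psum w s N
      from funext fun N => T.psum_const_mul C w s N]
    exact (hv s hs hst).const_mul C

lemma Dom.add {T : GridSeq} {p q : ℕ → ℕ → ℝ} (hp : T.Dom p) (hq : T.Dom q) :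
    T.Dom (p + q) := by
  intro t ht
  obtain ⟨w, v, hvc, hw, hv⟩ := hp t ht
  obtain ⟨w', v', hvc', hw', hv'⟩ := hq t ht
  refine ⟨w + w', v + v', hvc.add hvc', fun N i hi => ?_, fun s hs hst => ?_⟩
  · exact (abs_add_le _ _).trans (add_le_add (hw N i hi) (hw' N i hi))
  · rw [psum_add]; exact (hv s hs hst).add (hv' s hs hst)

lemma _root_.PathwiseIto.ContFV.dom {A : ℝ → ℝ} (hA : ContFV A) (T : GridSeq) :
    T.Dom (T.inc A) := by
  intro t ht
  obtain ⟨v, hvc, hv⟩ := hA t ht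
  refine ⟨T.inc v, fun s => v s - v 0, hvc.sub continuousOn_const, fun N i hi => ?_,
    fun s hs hst => T.tendsto_psum_inc hs (hvc.mono (Icc_subset_Icc_right hst))⟩
  obtain ⟨h1, h2⟩ := T.pt_mem_of_mem_upTo hi
  exact hv _ _ h1.1 ((T.grid N).pt_le_pt_succ i) h2.2

/-- `p` is dominated and its sums over `[0,t]` converge to `D t`. -/
structure Conv (T : GridSeq) (p : ℕ → ℕ → ℝ) (D : ℝ → ℝ) : Prop where
  dom : T.Dom p
  tendsto : ∀ t : ℝ, 0 ≤ t → Tendsto (T.psum p t) atTop (𝓝 (D t))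

lemma Conv.add {T : GridSeq} {p q : ℕ → ℕ → ℝ} {D E : ℝ → ℝ} (hp : T.Conv p D)
    (hq : T.Conv q E) : T.Conv (p + q) (D + E) where
  dom := hp.dom.add hq.dom
  tendsto t ht := by rw [psum_add]; exact (hp.tendsto t ht).add (hq.tendsto t ht)

lemma Conv.exists_sum {T : GridSeq} {ι : Type*} (s : Finset ι) {p : ι → ℕ → ℕ → ℝ}
    (h : ∀ k ∈ s, ∃ D, T.Conv (p k) D) : ∃ D, T.Conv (∑ k ∈ s, p k) D := by
  classical
  induction s using Finset.induction_on with
  | empty =>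
    refine ⟨fun _ => 0, fun t _ => ⟨fun _ _ => 0, fun _ => 0, continuousOn_const, by simp, ?_⟩, ?_⟩
    · intro s _ _
      rw [T.psum_zero_array]; exact tendsto_const_nhds
    · intro s _
      rw [Finset.sum_empty]
      exact tendsto_const_nhds.congr fun N => (congrFun (T.psum_zero_array s) N).symm
  | insert a s ha ih =>
    obtain ⟨D, hD⟩ := h a (Finset.mem_insert_self a s)
    obtain ⟨E, hE⟩ := ih fun k hk => h k (Finset.mem_insert_of_mem hk)
    rw [Finset.sum_insert ha]
    exact ⟨_, hD.add hE⟩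

/-- The limit `E` plays the role of `∫ Y dD`; domination survives the weight, so `E` is again
continuous and of finite variation. -/
lemma Conv.exists_left_mul {T : GridSeq} {p : ℕ → ℕ → ℝ} {D Y : ℝ → ℝ} (hp : T.Conv p D)
    (hY : ContinuousOn Y (Ici 0)) : ∃ E, T.Conv (T.left Y * p) E := by
  have h : ∀ t : ℝ, ∃ J, 0 ≤ t → Tendsto (T.psum (T.left Y * p) t) atTop (𝓝 J) := by
    intro t
    by_cases ht : 0 ≤ t
    · obtain ⟨J, hJ⟩ := exists_tendsto_psum_left_mul hp.dom.bdd hp.tendsto hY ht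
      exact ⟨J, fun _ => hJ⟩
    · exact ⟨0, fun h => absurd h ht⟩
  choose E hE using h
  exact ⟨E, hp.dom.left_mul hY, hE⟩

/-- Domination of the array on the intervals between `a` and `b` passes to the limit and bounds the
increment of `D` by that of the continuous limit `v`. -/
lemma Conv.contFV {T : GridSeq} {p : ℕ → ℕ → ℝ} {D : ℝ → ℝ} (hp : T.Conv p D) : ContFV D := by
  intro t ht
  obtain ⟨w, v, hvc, hw, hv⟩ := hp.dom t ht
  refine ⟨v, hvc, fun a b ha hab hbt => ?_⟩
  refine le_of_tendsto_of_tendsto'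
    ((hp.tendsto b (ha.trans hab)).sub (hp.tendsto a ha)).abs
    ((hv b (ha.trans hab) hbt).sub (hv a ha (hab.trans hbt))) fun N => ?_
  rw [psum_sub_psum _ _ hab, psum_sub_psum _ _ hab]
  refine (Finset.abs_sum_le_sum_abs _ _).trans (Finset.sum_le_sum fun i hi => hw N i ?_)
  exact (T.grid N).upTo_mono hbt (Finset.mem_sdiff.1 hi).1

lemma Conv.apply_zero {T : GridSeq} {p : ℕ → ℕ → ℝ} {D : ℝ → ℝ} (hp : T.Conv p D) : D 0 = 0 := by
  refine tendsto_nhds_unique (hp.tendsto 0 le_rfl) ?_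
  rw [show T.psum p 0 = fun _ => 0 from funext fun N => T.psum_zero p N]
  exact tendsto_const_nhds

/-- A convergent array may be exchanged for the increments of its limit; applied to squared
increments of `S`, this is the rule `(dS)² = d[S]`. -/
lemma Conv.null {T : GridSeq} {p : ℕ → ℕ → ℝ} {D : ℝ → ℝ} (hp : T.Conv p D) :
    T.Null (p - T.inc D) where
  bdd := hp.dom.bdd.sub (hp.contFV.dom T).bdd
  tendsto t ht := by
    rw [psum_sub]
    have := (hp.tendsto t ht).sub
      (T.tendsto_psum_inc ht (hp.contFV.continuousOn.mono Icc_subset_Ici_self))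
    simpa [hp.apply_zero] using this

lemma _root_.PathwiseIto.ContFV.conv {A : ℝ → ℝ} (hA : ContFV A) (T : GridSeq) :
    T.Conv (T.inc A) (fun t => A t - A 0) where
  dom := hA.dom T
  tendsto _ ht := T.tendsto_psum_inc ht (hA.continuousOn.mono Icc_subset_Ici_self)

lemma _root_.PathwiseIto.HasContinuousQV.conv {T : GridSeq} {S Q : ℝ → ℝ}
    (hQ : HasContinuousQV T S Q) : T.Conv (T.inc S * T.inc S) Q := by
  have h : ∀ t : ℝ, 0 ≤ t → Tendsto (T.psum (T.inc S * T.inc S) t) atTop (𝓝 (Q t)) := by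
    intro t ht
    rcases ht.eq_or_lt with rfl | ht0
    · rw [hQ.zero, show T.psum (T.inc S * T.inc S) 0 = fun _ => 0 from
        funext fun N => T.psum_zero _ N]
      exact tendsto_const_nhds
    · refine (hQ.tendsto t ht0).congr fun N => ?_
      simp [qvSum, psum, inc, sq]
  refine ⟨fun t _ => ⟨T.inc S * T.inc S, Q, hQ.continuousOn.mono Icc_subset_Ici_self,
    fun N i _ => ?_, fun s hs _ => h s hs⟩, h⟩
  exact (abs_of_nonneg (mul_self_nonneg _)).le

end GridSeq

/-! ### Itô calculus for processes given by their increments. -/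

/-- `X` has the dynamics `dX = h dS + κ dQ + ρ dΛ` in the sense of increments along the grids. -/
structure ItoProcess (T : GridSeq) (S Q Λ X h κ ρ : ℝ → ℝ) : Prop where
  continuousOn : ContinuousOn X (Ici 0)
  continuousOn_stock : ContinuousOn h (Ici 0)
  continuousOn_qv : ContinuousOn κ (Ici 0)
  continuousOn_bond : ContinuousOn ρ (Ici 0)
  null : T.Null (T.inc X - T.left h * T.inc S - T.left κ * T.inc Q - T.left ρ * T.inc Λ)

namespace ItoProcess

variable {T : GridSeq} {S Q Λ X h κ ρ Y h' κ' ρ' : ℝ → ℝ}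

lemma congr (hX : ItoProcess T S Q Λ X h κ ρ) (h0 : EqOn Y X (Ici 0)) (h1 : EqOn h' h (Ici 0))
    (h2 : EqOn κ' κ (Ici 0)) (h3 : EqOn ρ' ρ (Ici 0)) : ItoProcess T S Q Λ Y h' κ' ρ' where
  continuousOn := hX.continuousOn.congr h0
  continuousOn_stock := hX.continuousOn_stock.congr h1
  continuousOn_qv := hX.continuousOn_qv.congr h2
  continuousOn_bond := hX.continuousOn_bond.congr h3
  null := by
    have e0 : T.inc Y = T.inc X := by
      funext N i; simp only [GridSeq.inc, h0 ((T.grid N).pt_nonneg _)]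
    have e1 : T.left h' = T.left h := by funext N i; exact h1 ((T.grid N).pt_nonneg _)
    have e2 : T.left κ' = T.left κ := by funext N i; exact h2 ((T.grid N).pt_nonneg _)
    have e3 : T.left ρ' = T.left ρ := by funext N i; exact h3 ((T.grid N).pt_nonneg _)
    rw [e0, e1, e2, e3]; exact hX.null

lemma add (hX : ItoProcess T S Q Λ X h κ ρ) (hY : ItoProcess T S Q Λ Y h' κ' ρ') :
    ItoProcess T S Q Λ (fun t => X t + Y t) (fun t => h t + h' t) (fun t => κ t + κ' t)
      (fun t => ρ t + ρ' t) where
  continuousOn := hX.continuousOn.add hY.continuousOn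
  continuousOn_stock := hX.continuousOn_stock.add hY.continuousOn_stock
  continuousOn_qv := hX.continuousOn_qv.add hY.continuousOn_qv
  continuousOn_bond := hX.continuousOn_bond.add hY.continuousOn_bond
  null := by
    convert hX.null.add hY.null using 1
    funext N i
    simp only [GridSeq.inc, GridSeq.left, Pi.add_apply, Pi.sub_apply, Pi.mul_apply]
    ring

lemma const_mul (hX : ItoProcess T S Q Λ X h κ ρ) (c : ℝ) :
    ItoProcess T S Q Λ (fun t => c * X t) (fun t => c * h t) (fun t => c * κ t)
      (fun t => c * ρ t) where
  continuousOn := continuousOn_const.mul hX.continuousOn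
  continuousOn_stock := continuousOn_const.mul hX.continuousOn_stock
  continuousOn_qv := continuousOn_const.mul hX.continuousOn_qv
  continuousOn_bond := continuousOn_const.mul hX.continuousOn_bond
  null := by
    convert hX.null.left_mul (Y := fun _ => c) continuousOn_const using 1
    funext N i
    simp only [GridSeq.inc, GridSeq.left, Pi.sub_apply, Pi.mul_apply]
    ring

/-- The increments of an Itô process, up to their `dS` part, are of bounded total mass. -/
lemma bdd_sub (hX : ItoProcess T S Q Λ X h κ ρ) (hQ : ContFV Q) (hΛ : ContFV Λ) :
    T.Bdd (T.inc X - T.left h * T.inc S) := by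
  convert (hX.null.bdd.add ((hQ.dom T).bdd.left_mul hX.continuousOn_qv)).add
    ((hΛ.dom T).bdd.left_mul hX.continuousOn_bond) using 1
  funext N i
  simp only [Pi.add_apply, Pi.sub_apply, Pi.mul_apply]
  ring

/-- The quadratic covariation of two Itô processes. -/
lemma null_inc_mul_inc (hX : ItoProcess T S Q Λ X h κ ρ) (hY : ItoProcess T S Q Λ Y h' κ' ρ')
    (hS : ContinuousOn S (Ici 0)) (hQ : HasContinuousQV T S Q) (hΛ : ContFV Λ) :
    T.Null (T.inc X * T.inc Y - T.left (fun t => h t * h' t) * T.inc Q) := by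
  have hQ' := hQ.conv.contFV
  -- The difference splits as `h h' ((ΔS)² - ΔQ) + h ΔS (ΔY - h' ΔS) + (ΔX - h ΔS) ΔY`. The first
  -- term is null by quadratic variation; in the other two, an increment of a continuous path
  -- multiplies an array of bounded mass.
  convert ((hQ.conv.null.left_mul (hX.continuousOn_stock.mul hY.continuousOn_stock)).add
    ((GridSeq.StrongNull.inc_mul (hY.bdd_sub hQ' hΛ) hS).left_mul hX.continuousOn_stock).null).add
    (GridSeq.StrongNull.inc_mul (hX.bdd_sub hQ' hΛ) hY.continuousOn).null using 1
  funext N i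
  simp only [GridSeq.left, Pi.add_apply, Pi.sub_apply, Pi.mul_apply]
  ring

/-- The product rule. -/
lemma mul (hX : ItoProcess T S Q Λ X h κ ρ) (hY : ItoProcess T S Q Λ Y h' κ' ρ')
    (hS : ContinuousOn S (Ici 0)) (hQ : HasContinuousQV T S Q) (hΛ : ContFV Λ) :
    ItoProcess T S Q Λ (fun t => X t * Y t) (fun t => X t * h' t + Y t * h t)
      (fun t => X t * κ' t + Y t * κ t + h t * h' t) (fun t => X t * ρ' t + Y t * ρ t) where
  continuousOn := hX.continuousOn.mul hY.continuousOn
  continuousOn_stock := (hX.continuousOn.mul hY.continuousOn_stock).add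
    (hY.continuousOn.mul hX.continuousOn_stock)
  continuousOn_qv := ((hX.continuousOn.mul hY.continuousOn_qv).add
    (hY.continuousOn.mul hX.continuousOn_qv)).add
    (hX.continuousOn_stock.mul hY.continuousOn_stock)
  continuousOn_bond := (hX.continuousOn.mul hY.continuousOn_bond).add
    (hY.continuousOn.mul hX.continuousOn_bond)
  null := by
    convert ((hY.null.left_mul hX.continuousOn).add (hX.null.left_mul hY.continuousOn)).add
      (hX.null_inc_mul_inc hY hS hQ hΛ) using 1
    funext N i
    simp only [GridSeq.inc, GridSeq.left, Pi.add_apply, Pi.sub_apply, Pi.mul_apply]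
    ring

/-- Itô's formula for the exponential. -/
lemma exp (hX : ItoProcess T S Q Λ X h κ ρ)
    (hS : ContinuousOn S (Ici 0)) (hQ : HasContinuousQV T S Q) (hΛ : ContFV Λ) :
    ItoProcess T S Q Λ (fun t => Real.exp (X t)) (fun t => Real.exp (X t) * h t)
      (fun t => Real.exp (X t) * (κ t + h t * h t / 2)) (fun t => Real.exp (X t) * ρ t) := by
  have hE : ContinuousOn (fun t => Real.exp (X t)) (Ici 0) := hX.continuousOn.rexp
  have hXX := hX.null_inc_mul_inc hX hS hQ hΛ
  have hb : T.Bdd (T.inc X * T.inc X) := by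
    convert hXX.bdd.add ((hQ.conv.contFV.dom T).bdd.left_mul
      (Y := fun t => h t * h t) (hX.continuousOn_stock.mul hX.continuousOn_stock)) using 1
    funext N i
    simp only [Pi.add_apply, Pi.sub_apply]
    ring
  have herr : T.StrongNull (fun N i => Real.exp (T.inc X N i) - 1 - T.inc X N i
      - (T.inc X * T.inc X) N i / 2) := by
    refine GridSeq.strongNull_of_le hb fun t _ ε hε => ?_
    -- The bound `1` is what the remainder estimate for the exponential requires; the bound `ε`
    -- turns the cubic remainder into `ε` times the square.
    filter_upwards [T.eventually_abs_inc_le (hX.continuousOn.mono Icc_subset_Ici_self)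
      (lt_min hε zero_lt_one)] with N hN i hi
    have h1 := hN i hi
    have h2 := Real.exp_bound (h1.trans (min_le_right _ _)) (n := 3) (by norm_num)
    simp only [Finset.sum_range_succ, Finset.sum_range_zero, Nat.factorial] at h2
    norm_num at h2
    set d := T.inc X N i
    have h3 : |d| ^ 3 ≤ ε * (|d| * |d|) := by
      have := mul_le_mul_of_nonneg_right (h1.trans (min_le_left _ _))
        (mul_nonneg (abs_nonneg d) (abs_nonneg d))
      calc |d| ^ 3 = |d| * (|d| * |d|) := by ring
        _ ≤ _ := this
    have h4 : Real.exp d - 1 - d - d * d / 2 = Real.exp d - (1 + d + d ^ 2 / 2) := by ring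
    simp only [Pi.mul_apply]
    change |Real.exp d - 1 - d - d * d / 2| ≤ ε * |d * d|
    rw [h4, abs_mul]
    refine h2.trans (le_trans ?_ h3)
    have : 0 ≤ |d| ^ 3 := by positivity
    linarith
  refine ⟨hE, hE.mul hX.continuousOn_stock, hE.mul (hX.continuousOn_qv.add
    ((hX.continuousOn_stock.mul hX.continuousOn_stock).div_const 2)),
    hE.mul hX.continuousOn_bond, ?_⟩
  -- With `d = ΔX`, the expansion `e^d - 1 = d + d²/2 + o(d²)` is weighted by `exp (X tᵢ)`; the
  -- three summands treat these three terms in order.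
  convert ((hX.null.left_mul hE).add
    ((hXX.left_mul (Y := fun _ => 1 / 2) continuousOn_const).left_mul hE)).add
    (herr.left_mul hE).null using 1
  funext N i
  simp only [GridSeq.inc, GridSeq.left, Pi.add_apply, Pi.sub_apply, Pi.mul_apply, Real.exp_sub]
  have : Real.exp (X ((T.grid N).pt i)) ≠ 0 := (Real.exp_pos _).ne'
  field_simp
  ring

/-- Without `dQ` part, the Itô integral of the `dS` coefficient exists. -/
lemma hasItoIntegral (hX : ItoProcess T S Q Λ X h (fun _ => 0) ρ) {R t : ℝ} (ht : 0 ≤ t)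
    (hR : Tendsto (T.psum (T.left ρ * T.inc Λ) t) atTop (𝓝 R)) :
    HasItoIntegral T S h t (X t - X 0 - R) := by
  have h1 := ((T.tendsto_psum_inc ht (hX.continuousOn.mono Icc_subset_Ici_self)).sub hR).sub
    (hX.null.tendsto t ht)
  rw [sub_zero] at h1
  refine h1.congr fun N => ?_
  simp only [GridSeq.psum, itoSum, ← Finset.sum_sub_distrib]
  refine Finset.sum_congr rfl fun i _ => ?_
  simp only [GridSeq.inc, GridSeq.left, Pi.sub_apply, Pi.mul_apply]
  ring

/-- A process with vanishing coefficients is constant. -/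
lemma eq_of_coeff_zero
    (hX : ItoProcess T S Q Λ X (fun _ => 0) (fun _ => 0) (fun _ => 0)) {t : ℝ} (ht : 0 ≤ t) :
    X t = X 0 := by
  have h1 := T.tendsto_psum_inc ht (hX.continuousOn.mono Icc_subset_Ici_self)
  have h2 := hX.null.tendsto t ht
  have h3 : T.inc X - T.left (fun _ => 0) * T.inc S - T.left (fun _ => 0) * T.inc Q
      - T.left (fun _ => 0) * T.inc Λ = T.inc X := by
    funext N i; simp [GridSeq.left]
  rw [h3] at h2
  linarith [tendsto_nhds_unique h1 h2]

end ItoProcess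
end PathwiseIto

/-! ### Primitives with respect to an atomless measure. -/

namespace PathwiseIto

section Primitive

variable {ν : Measure ℝ} {w ρ : ℝ → ℝ}

lemma integrableOn_continuousOn_mul (hw : ∀ t : ℝ, 0 ≤ t → IntegrableOn w (Icc 0 t) ν)
    (hρ : ContinuousOn ρ (Ici 0)) {t : ℝ} (ht : 0 ≤ t) :
    IntegrableOn (fun s => ρ s * w s) (Icc 0 t) ν :=
  (hw t ht).continuousOn_mul (hρ.mono Icc_subset_Ici_self) isCompact_Icc

lemma setIntegral_Ioc_sub (hw : ∀ t : ℝ, 0 ≤ t → IntegrableOn w (Icc 0 t) ν) {a b : ℝ}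
    (ha : 0 ≤ a) (hab : a ≤ b) :
    ∫ s in Ioc 0 b, w s ∂ν - ∫ s in Ioc 0 a, w s ∂ν = ∫ s in Ioc a b, w s ∂ν := by
  have hb := (hw b (ha.trans hab)).mono_set Ioc_subset_Icc_self
  rw [← Ioc_union_Ioc_eq_Ioc ha hab, setIntegral_union (Ioc_disjoint_Ioc_of_le le_rfl)
    measurableSet_Ioc (hb.mono_set (Ioc_subset_Ioc_right hab))
    (hb.mono_set (Ioc_subset_Ioc_left ha))]
  ring

/-- The primitive of `|w|` controls the increments; it is continuous because `ν` has no atoms. -/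
lemma contFV_setIntegral [NullSingletonClass ν] (hw : ∀ t : ℝ, 0 ≤ t → IntegrableOn w (Icc 0 t) ν) :
    ContFV (fun t => ∫ s in Ioc 0 t, w s ∂ν) := by
  intro t ht
  refine ⟨fun t => ∫ s in Ioc 0 t, |w s| ∂ν,
    intervalIntegral.continuousOn_primitive (hw t ht.le).abs, fun a b ha hab hbt => ?_⟩
  rw [setIntegral_Ioc_sub hw ha hab, setIntegral_Ioc_sub (fun t ht => (hw t ht).abs) ha hab]
  exact abs_integral_le_integral_abs

/-- Riemann sums approximate the increments of `∫ ρ w dν`. -/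
lemma strongNull_setIntegral [NullSingletonClass ν] (T : GridSeq)
    (hw : ∀ t : ℝ, 0 ≤ t → IntegrableOn w (Icc 0 t) ν)
    (hρ : ContinuousOn ρ (Ici 0)) :
    T.StrongNull (T.inc (fun t => ∫ s in Ioc 0 t, ρ s * w s ∂ν)
      - T.left ρ * T.inc (fun t => ∫ s in Ioc 0 t, w s ∂ν)) := by
  have hwa : ∀ t : ℝ, 0 ≤ t → IntegrableOn (fun s => |w s|) (Icc 0 t) ν :=
    fun t ht => (hw t ht).abs
  refine GridSeq.strongNull_of_le ((contFV_setIntegral hwa).dom T).bdd fun t ht ε hε => ?_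
  filter_upwards [T.eventually_osc_le (hρ.mono (Icc_subset_Ici_self : Icc 0 t ⊆ _)) hε]
    with N hN i hi
  have h0 := (T.grid N).pt_nonneg i
  have h1 := (T.grid N).pt_le_pt_succ i
  have hN' := hN i hi
  simp only [Pi.sub_apply, Pi.mul_apply, GridSeq.inc, GridSeq.left]
  set a := (T.grid N).pt i
  set b := (T.grid N).pt (i + 1)
  have hsub : Ioc a b ⊆ Icc 0 b := fun x hx => ⟨h0.trans hx.1.le, hx.2⟩
  have hwi := (hw b (h0.trans h1)).mono_set hsub
  have hρi := (integrableOn_continuousOn_mul hw hρ (h0.trans h1)).mono_set hsub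
  rw [setIntegral_Ioc_sub (fun t ht => integrableOn_continuousOn_mul hw hρ ht) h0 h1,
    setIntegral_Ioc_sub hw h0 h1, setIntegral_Ioc_sub hwa h0 h1, ← integral_const_mul,
    ← integral_sub hρi (hwi.const_mul _),
    abs_of_nonneg (a := ∫ s in Ioc a b, |w s| ∂ν) (integral_nonneg fun s => abs_nonneg (w s)),
    ← integral_const_mul]
  refine abs_integral_le_integral_abs.trans (setIntegral_mono_on
    (hρi.sub (hwi.const_mul _)).abs (hwi.abs.const_mul _) measurableSet_Ioc fun s hs => ?_)
  rw [← sub_mul, abs_mul]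
  refine mul_le_mul_of_nonneg_right ?_ (abs_nonneg _)
  simpa [Real.dist_eq] using hN' s ⟨hs.1.le, hs.2⟩

lemma tendsto_psum_left_mul_setIntegral [NullSingletonClass ν] (T : GridSeq)
    (hw : ∀ t : ℝ, 0 ≤ t → IntegrableOn w (Icc 0 t) ν) (hρ : ContinuousOn ρ (Ici 0))
    {t : ℝ} (ht : 0 ≤ t) :
    Tendsto (T.psum (T.left ρ * T.inc (fun t => ∫ s in Ioc 0 t, w s ∂ν)) t) atTop
      (𝓝 (∫ s in Ioc 0 t, ρ s * w s ∂ν)) := by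
  have hc := contFV_setIntegral (fun t ht => integrableOn_continuousOn_mul hw hρ (t := t) ht)
  have h1 := (T.tendsto_psum_inc ht (hc.continuousOn.mono Icc_subset_Ici_self)).sub
    ((strongNull_setIntegral T hw hρ).null.tendsto t ht)
  simp only [Ioc_self, Measure.restrict_empty, integral_zero_measure, sub_zero] at h1
  refine h1.congr fun N => ?_
  rw [T.psum_sub]
  ring

end Primitive

section QuadraticVariation

variable {T : GridSeq} {X Q : ℝ → ℝ}

lemma HasContinuousQV.measure_singleton (h : HasContinuousQV T X Q) (x : ℝ) :
    h.measure {x} = 0 := by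
  have hc : Continuous h.stieltjes := h.continuousOn.comp_continuous
    (continuous_id.max continuous_const) fun _ => mem_Ici.2 (le_max_right _ _)
  rw [HasContinuousQV.measure, StieltjesFunction.measure_singleton,
    hc.continuousWithinAt.leftLim_eq]
  simp

lemma HasContinuousQV.nullSingletonClass (h : HasContinuousQV T X Q) :
    NullSingletonClass h.measure := ⟨h.measure_singleton⟩

lemma HasContinuousQV.integrableOn_one (h : HasContinuousQV T X Q) (t : ℝ) :
    IntegrableOn (fun _ => (1 : ℝ)) (Icc 0 t) h.measure := by
  refine integrableOn_const (ne_of_lt ?_)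
  rw [HasContinuousQV.measure]
  exact isCompact_Icc.measure_lt_top

lemma HasContinuousQV.setIntegral_one (h : HasContinuousQV T X Q) {t : ℝ} (ht : 0 ≤ t) :
    ∫ _ in Ioc 0 t, (1 : ℝ) ∂h.measure = Q t := by
  have e1 : h.stieltjes t = Q t := by
    change Q (max t 0) = Q t
    rw [max_eq_left ht]
  have e2 : h.stieltjes 0 = 0 := by
    change Q (max 0 0) = 0
    rw [max_self, h.zero]
  have h0 : 0 ≤ Q t := by
    rw [← h.zero]; exact h.monotoneOn (mem_Ici.2 le_rfl) ht ht
  rw [setIntegral_const, Measure.real, HasContinuousQV.measure, StieltjesFunction.measure_Ioc,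
    e1, e2, sub_zero, ENNReal.toReal_ofReal h0, smul_eq_mul, mul_one]

end QuadraticVariation

namespace ItoProcess

variable {T : GridSeq} {S Q Λ κ ρ : ℝ → ℝ}

lemma integral_qv (hQ : HasContinuousQV T S Q) (hκ : ContinuousOn κ (Ici 0)) :
    ItoProcess T S Q Λ (fun t => ∫ s in Ioc 0 t, κ s ∂hQ.measure) (fun _ => 0) κ
      (fun _ => 0) := by
  have := hQ.nullSingletonClass
  have hw := fun (t : ℝ) (_ : 0 ≤ t) => hQ.integrableOn_one t
  have h1 := (strongNull_setIntegral T hw hκ).null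
  simp only [mul_one] at h1
  have hc := contFV_setIntegral (fun t ht => integrableOn_continuousOn_mul hw hκ (t := t) ht)
  simp only [mul_one] at hc
  refine ⟨hc.continuousOn, continuousOn_const, hκ, continuousOn_const, ?_⟩
  convert h1 using 1
  funext N i
  have e : T.inc (fun t => ∫ _ in Ioc 0 t, (1 : ℝ) ∂hQ.measure) N i = T.inc Q N i := by
    simp only [GridSeq.inc, hQ.setIntegral_one ((T.grid N).pt_nonneg _)]
  simp only [Pi.sub_apply, Pi.mul_apply, e]
  simp [GridSeq.left]

lemma integral_bond {r : ℝ → ℝ} (hr : ∀ t : ℝ, 0 ≤ t → IntegrableOn r (Icc 0 t))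
    (hρ : ContinuousOn ρ (Ici 0)) :
    ItoProcess T S Q (fun t => ∫ s in Ioc 0 t, r s) (fun t => ∫ s in Ioc 0 t, ρ s * r s)
      (fun _ => 0) (fun _ => 0) ρ := by
  refine ⟨(contFV_setIntegral fun t ht => integrableOn_continuousOn_mul hr hρ ht).continuousOn,
    continuousOn_const, continuousOn_const, hρ, ?_⟩
  convert (strongNull_setIntegral T hr hρ).null using 1
  funext N i
  simp [GridSeq.left]

end ItoProcess
end PathwiseIto

/-! ### The pathwise Itô formula. -/

namespace PathwiseIto

section Parametric

/-- Continuous differentiability of an integral over `[0,1]` depending on a parameter. -/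
lemma contDiff_one_intervalIntegral {H : Type*} [NormedAddCommGroup H] [NormedSpace ℝ H]
    [FiniteDimensional ℝ H] {G : H × ℝ → ℝ} (hG : ContDiff ℝ 1 G) :
    ContDiff ℝ 1 (fun x => ∫ y in (0 : ℝ)..1, G (x, y)) := by
  have : ProperSpace H := FiniteDimensional.proper_real H
  set G' : H → ℝ → H →L[ℝ] ℝ := fun x y =>
    (fderiv ℝ G (x, y)).comp (ContinuousLinearMap.inl ℝ H ℝ) with hG'
  have hG'c : Continuous (Function.uncurry G') := by
    have h1 : Continuous (fderiv ℝ G) := hG.continuous_fderiv one_ne_zero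
    exact (ContinuousLinearMap.compL ℝ H (H × ℝ) ℝ).flip
      (ContinuousLinearMap.inl ℝ H ℝ) |>.continuous.comp h1
  have hd : ∀ x y, HasFDerivAt (fun x => G (x, y)) (G' x y) x := by
    intro x y
    have h1 := (hG.differentiable one_ne_zero (x, y)).hasFDerivAt
    exact h1.comp x ((hasFDerivAt_id x).prodMk (hasFDerivAt_const y x))
  refine contDiff_one_iff_hasFDerivAt.2 ⟨fun x => ∫ y in (0 : ℝ)..1, G' x y,
    intervalIntegral.continuous_parametric_intervalIntegral_of_continuous' hG'c 0 1, fun x₀ => ?_⟩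
  obtain ⟨C, hC⟩ := ((isCompact_closedBall x₀ 1).prod (isCompact_Icc (a := (0 : ℝ)) (b := 1))
    ).exists_bound_of_continuousOn hG'c.continuousOn
  have hGc := hG.continuous
  refine intervalIntegral.hasFDerivAt_integral_of_dominated_of_fderiv_le (bound := fun _ => C)
    (Metric.closedBall_mem_nhds x₀ one_pos) (Eventually.of_forall fun x => ?_) ?_ ?_ ?_ ?_ ?_
  · exact (hGc.comp (by fun_prop : Continuous fun y : ℝ => (x, y))).aestronglyMeasurable
  · exact (hGc.comp (by fun_prop : Continuous fun y : ℝ => (x₀, y))).intervalIntegrable _ _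
  · exact (hG'c.comp (by fun_prop : Continuous fun y : ℝ => (x₀, y))).aestronglyMeasurable
  · refine Eventually.of_forall fun y hy x hx => hC (x, y) ⟨hx, ?_⟩
    rw [uIoc_of_le zero_le_one] at hy
    exact ⟨hy.1.le, hy.2⟩
  · exact intervalIntegrable_const
  · exact Eventually.of_forall fun y _ x _ => hd x y

/-- A `C¹` function has a `C¹` antiderivative with respect to its last variable. -/
lemma exists_contDiff_antideriv {E : Type*} [NormedAddCommGroup E] [NormedSpace ℝ E]
    [FiniteDimensional ℝ E] {g : E × ℝ → ℝ} (hg : ContDiff ℝ 1 g) :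
    ∃ f : E × ℝ → ℝ, ContDiff ℝ 1 f ∧
      ∀ a x, HasDerivAt (fun y => f (a, y)) (g (a, x)) x := by
  -- Rescaling `∫₀ˣ g(a,y) dy` to the fixed interval `[0,1]` reduces joint `C¹` regularity in
  -- `(a,x)` to differentiation under the integral sign.
  refine ⟨fun p => p.2 * ∫ y in (0 : ℝ)..1, g (p.1, p.2 * y), ?_, fun a x => ?_⟩
  · refine contDiff_snd.mul (contDiff_one_intervalIntegral
      (G := fun q : (E × ℝ) × ℝ => g (q.1.1, q.1.2 * q.2)) ?_)
    exact hg.comp (by fun_prop)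
  · have h1 : (fun x => x * ∫ y in (0 : ℝ)..1, g (a, x * y)) =
        fun x => ∫ y in (0 : ℝ)..x, g (a, y) := by
      funext x
      rw [intervalIntegral.mul_integral_comp_mul_left (f := fun y => g (a, y))]
      simp
    simp only [h1]
    have hc : Continuous fun y => g (a, y) := hg.continuous.comp (by fun_prop)
    exact hc.integral_hasStrictDerivAt 0 x |>.hasDerivAt

end Parametric

/-- Second order Taylor estimate. -/
lemma abs_taylor_two_le {φ φ' φ'' : ℝ → ℝ} (h1 : ∀ y, HasDerivAt φ (φ' y) y)
    (h2 : ∀ y, HasDerivAt φ' (φ'' y) y) {x z c ε : ℝ}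
    (hc : ∀ y ∈ uIcc x z, |φ'' y - c| ≤ ε) :
    |φ z - φ x - φ' x * (z - x) - c / 2 * ((z - x) * (z - x))| ≤ ε * ((z - x) * (z - x)) := by
  have hε : 0 ≤ ε := (abs_nonneg _).trans (hc x left_mem_uIcc)
  have hu : ∀ y ∈ uIcc x z, |φ' y - φ' x - c * (y - x)| ≤ ε * |z - x| := by
    intro y hy
    have := (convex_uIcc x z).norm_image_sub_le_of_norm_hasDerivWithin_le
      (f := fun y => φ' y - c * y) (f' := fun y => φ'' y - c * 1) (C := ε)
      (fun y _ => ((h2 y).sub ((hasDerivAt_id y).const_mul c)).hasDerivWithinAt)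
      (fun y hy => by simpa using hc y hy) left_mem_uIcc hy
    rw [Real.norm_eq_abs, Real.norm_eq_abs] at this
    calc |φ' y - φ' x - c * (y - x)| = |φ' y - c * y - (φ' x - c * x)| := by ring_nf
      _ ≤ ε * |y - x| := this
      _ ≤ ε * |z - x| := mul_le_mul_of_nonneg_left (abs_sub_left_of_mem_uIcc hy) hε
  have := (convex_uIcc x z).norm_image_sub_le_of_norm_hasDerivWithin_le
    (f := fun y => φ y - φ' x * (y - x) - c / 2 * (y - x) ^ 2)
    (f' := fun y => φ' y - φ' x * 1 - c / 2 * (2 * (y - x))) (C := ε * |z - x|)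
    (fun y _ => ?_) (fun y hy => ?_) left_mem_uIcc right_mem_uIcc
  · rw [Real.norm_eq_abs, Real.norm_eq_abs] at this
    calc _ = |φ z - φ' x * (z - x) - c / 2 * (z - x) ^ 2 -
          (φ x - φ' x * (x - x) - c / 2 * (x - x) ^ 2)| := by ring_nf
      _ ≤ _ := this
      _ = ε * (|z - x| * |z - x|) := by ring
      _ = _ := by rw [abs_mul_abs_self]
  · refine HasDerivAt.hasDerivWithinAt ?_
    have hid : HasDerivAt (fun y : ℝ => y - x) 1 y := (hasDerivAt_id y).sub_const x
    refine ((h1 y).sub (hid.const_mul (φ' x))).sub ?_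
    exact ((hid.pow 2).const_mul (c / 2)).congr_deriv (by simp)
  · rw [Real.norm_eq_abs]
    convert hu y hy using 2
    ring

/-- Uniform continuity of a continuous function near a compact path. -/
lemma exists_pos_forall_dist_le {E F : Type*} [PseudoMetricSpace E] [ProperSpace E]
    [PseudoMetricSpace F] {h : E → F} (hh : Continuous h) {z : ℝ → E} {t : ℝ}
    (hz : ContinuousOn z (Icc 0 t)) {ε : ℝ} (hε : 0 < ε) :
    ∃ δ, 0 < δ ∧ ∀ s ∈ Icc 0 t, ∀ p, dist p (z s) ≤ δ → dist (h p) (h (z s)) ≤ ε := by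
  have hK : IsCompact (z '' Icc 0 t) := isCompact_Icc.image_of_continuousOn hz
  -- The points `p` need not lie on the path: the Itô formula evaluates derivatives at mixed points
  -- such as `(A u, S v)`. A compact neighbourhood of the path is therefore needed.
  have huc := (hK.cthickening (r := 1)).uniformContinuousOn_of_continuous hh.continuousOn
  rw [Metric.uniformContinuousOn_iff] at huc
  obtain ⟨δ, hδ, H⟩ := huc ε hε
  refine ⟨min (δ / 2) 1, by positivity, fun s hs p hp => (H p ?_ (z s) ?_ ?_).le⟩
  · exact Metric.mem_cthickening_of_dist_le p (z s) 1 _ (mem_image_of_mem z hs)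
      (hp.trans (min_le_right _ _))
  · exact Metric.self_subset_cthickening _ (mem_image_of_mem z hs)
  · exact lt_of_le_of_lt (hp.trans (min_le_left _ _)) (by linarith)

namespace GridSeq

lemma Bdd.abs {T : GridSeq} {p : ℕ → ℕ → ℝ} (hp : T.Bdd p) : T.Bdd (fun N i => |p N i|) := by
  simpa [Bdd] using hp

lemma Bdd.sum {T : GridSeq} {ι : Type*} (s : Finset ι) {p : ι → ℕ → ℕ → ℝ}
    (h : ∀ k ∈ s, T.Bdd (p k)) : T.Bdd (∑ k ∈ s, p k) := by
  classical
  induction s using Finset.induction_on with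
  | empty => exact fun t _ => ⟨0, by simp [psum]⟩
  | insert a s ha ih =>
    rw [Finset.sum_insert ha]
    exact (h a (Finset.mem_insert_self a s)).add
      (ih fun k hk => h k (Finset.mem_insert_of_mem hk))

end GridSeq

/-- Pathwise Itô formula: if `f` is an antiderivative of the `C¹` function `g` in the last variable,
then `f(A, S)` minus a continuous finite variation path is the integral of `g(A, S)` against `S`. -/
lemma exists_itoProcess {T : GridSeq} {S Q Λ : ℝ → ℝ} (hS : ContinuousOn S (Ici 0))
    (hQ : HasContinuousQV T S Q) {n : ℕ} {g f : (Fin n → ℝ) × ℝ → ℝ} {A : ℝ → Fin n → ℝ}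
    (hg : ContDiff ℝ 1 g) (hf : ContDiff ℝ 1 f)
    (hfg : ∀ a x, HasDerivAt (fun y => f (a, y)) (g (a, x)) x)
    (hA : ∀ k, ContFV (fun t => A t k)) :
    ∃ D : ℝ → ℝ, ContFV D ∧ ItoProcess T S Q Λ (fun t => f (A t, S t) - D t)
      (fun t => g (A t, S t)) (fun _ => 0) (fun _ => 0) := by
  have hAc : ContinuousOn A (Ici 0) := continuousOn_pi.2 fun k => (hA k).continuousOn
  have hz : ContinuousOn (fun t => (A t, S t)) (Ici 0) := hAc.prodMk hS
  have hf'c : Continuous (fderiv ℝ f) := hf.continuous_fderiv one_ne_zero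
  have hg'c : Continuous (fderiv ℝ g) := hg.continuous_fderiv one_ne_zero
  set fa : Fin n → ℝ → ℝ := fun k t => fderiv ℝ f (A t, S t) (Pi.single k 1, 0) with hfa
  set gx : ℝ → ℝ := fun t => fderiv ℝ g (A t, S t) (0, 1) / 2 with hgx
  have hfac : ∀ k, ContinuousOn (fa k) (Ici 0) := fun k =>
    (hf'c.comp_continuousOn hz).clm_apply continuousOn_const
  have hgxc : ContinuousOn gx (Ici 0) :=
    ((hg'c.comp_continuousOn hz).clm_apply continuousOn_const).div_const 2
  -- `D₁` is `∑ₖ ∫ ∂f/∂aₖ dAᵏ`, and `D₂` below is `½ ∫ ∂g/∂x d[S]`.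
  obtain ⟨D₁, hD₁⟩ := GridSeq.Conv.exists_sum (T := T) Finset.univ
    (p := fun k => T.left (fa k) * T.inc (fun t => A t k))
    fun k _ => ((hA k).conv T).exists_left_mul (hfac k)
  obtain ⟨D₂, hD₂⟩ := hQ.conv.exists_left_mul hgxc
  have hD := hD₁.add hD₂
  have hb : T.Bdd ((∑ k, fun N i => |T.inc (fun t => A t k) N i|) + T.inc S * T.inc S) :=
    (GridSeq.Bdd.sum _ fun k _ => ((hA k).dom T).bdd.abs).add hQ.conv.dom.bdd
  have herr : T.StrongNull (T.inc (fun t => f (A t, S t)) - T.left (fun t => g (A t, S t)) * T.inc S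
      - (∑ k, T.left (fa k) * T.inc (fun t => A t k) + T.left gx * (T.inc S * T.inc S))) := by
    -- The increment of `f(A,S)` is split at the intermediate point `(A u, S v)`: first order in `A`
    -- (`e1`), second order in `S` (`e2`). Only `f(a, ·)` is expanded to second order, which needs
    -- no more than `g` being `C¹`.
    refine GridSeq.strongNull_of_le hb fun t ht ε hε => ?_
    have hzt := hz.mono (Icc_subset_Ici_self : Icc 0 t ⊆ Ici 0)
    obtain ⟨δ₁, hδ₁, H₁⟩ := exists_pos_forall_dist_le hf'c hzt hε
    obtain ⟨δ₂, hδ₂, H₂⟩ := exists_pos_forall_dist_le hg'c hzt hε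
    filter_upwards [T.eventually_osc_le hzt (lt_min hδ₁ hδ₂)] with N hN i hi
    have hosc := hN i hi _ (right_mem_Icc.2 ((T.grid N).pt_le_pt_succ i))
    have hmem := (T.pt_mem_of_mem_upTo hi).1
    simp only [Pi.sub_apply, Pi.add_apply, Pi.mul_apply, Finset.sum_apply, GridSeq.inc,
      GridSeq.left, hfa, hgx]
    set u := (T.grid N).pt i
    set v := (T.grid N).pt (i + 1)
    rw [Prod.dist_eq, max_le_iff] at hosc
    obtain ⟨hoA, hoS⟩ := hosc
    have hlin : ∑ k, fderiv ℝ f (A u, S u) (Pi.single k 1, 0) * (A v k - A u k)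
        = fderiv ℝ f (A u, S u) ((A v, S v) - (A u, S v)) := by
      have : ((A v, S v) - (A u, S v) : (Fin n → ℝ) × ℝ)
          = ∑ k, (A v k - A u k) • ((Pi.single k 1, 0) : (Fin n → ℝ) × ℝ) := by
        refine Prod.ext ?_ ?_
        · rw [Prod.fst_sum]
          funext j
          simp [Finset.sum_apply, Pi.single_apply]
        · rw [Prod.snd_sum]; simp
      rw [this, map_sum]
      refine Finset.sum_congr rfl fun k _ => ?_
      rw [map_smul, smul_eq_mul, mul_comm]
    have e1 : |f (A v, S v) - f (A u, S v) -
        fderiv ℝ f (A u, S u) ((A v, S v) - (A u, S v))| ≤ ε * ∑ k, |A v k - A u k| := by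
      have := (convex_closedBall (A u, S u) δ₁).norm_image_sub_le_of_norm_fderiv_le' (𝕜 := ℝ)
        (f := f) (C := ε) (φ := fderiv ℝ f (A u, S u)) (x := (A u, S v)) (y := (A v, S v))
        (fun p _ => hf.differentiable one_ne_zero p)
        (fun p hp => by simpa [dist_eq_norm] using H₁ u hmem p hp)
        (by
          rw [Metric.mem_closedBall, Prod.dist_eq]
          exact max_le (by simpa using hδ₁.le) (hoS.trans (min_le_left _ _)))
        (by
          rw [Metric.mem_closedBall, Prod.dist_eq]
          exact max_le (hoA.trans (min_le_left _ _)) (hoS.trans (min_le_left _ _)))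
      rw [Real.norm_eq_abs] at this
      refine this.trans (mul_le_mul_of_nonneg_left ?_ hε.le)
      rw [Prod.mk_sub_mk, sub_self, Prod.norm_mk, norm_zero, max_eq_left (norm_nonneg _),
        pi_norm_le_iff_of_nonneg (Finset.sum_nonneg fun k _ => abs_nonneg _)]
      exact fun k => Finset.single_le_sum (f := fun k => |A v k - A u k|)
        (fun k _ => abs_nonneg _) (Finset.mem_univ k)
    have e2 : |f (A u, S v) - f (A u, S u) - g (A u, S u) * (S v - S u)
        - fderiv ℝ g (A u, S u) (0, 1) / 2 * ((S v - S u) * (S v - S u))|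
        ≤ ε * ((S v - S u) * (S v - S u)) := by
      refine abs_taylor_two_le (φ := fun y => f (A u, y)) (φ' := fun y => g (A u, y))
        (φ'' := fun y => fderiv ℝ g (A u, y) (0, 1)) (fun y => hfg (A u) y) (fun y => ?_)
        (fun y hy => ?_)
      · have h1 := (hg.differentiable one_ne_zero (A u, y)).hasFDerivAt
        exact h1.comp_hasDerivAt y ((hasDerivAt_const y (A u)).prodMk (hasDerivAt_id y))
      · have h1 := H₂ u hmem (A u, y) (by
          rw [Prod.dist_eq, dist_self, max_eq_right dist_nonneg, Real.dist_eq]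
          refine (abs_sub_left_of_mem_uIcc hy).trans ?_
          rw [Real.dist_eq] at hoS
          exact hoS.trans (min_le_right _ _))
        rw [← sub_apply, ← Real.norm_eq_abs]
        refine ((fderiv ℝ g (A u, y) - fderiv ℝ g (A u, S u)).le_opNorm _).trans ?_
        rw [dist_eq_norm] at h1
        simpa [Prod.norm_mk] using h1
    rw [hlin, abs_of_nonneg (a := ∑ k, |A v k - A u k| + (S v - S u) * (S v - S u))
      (add_nonneg (Finset.sum_nonneg fun k _ => abs_nonneg _) (mul_self_nonneg _)), mul_add]
    refine le_trans (le_of_eq ?_) ((abs_add_le _ _).trans (add_le_add e1 e2))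
    congr 1
    ring
  refine ⟨D₁ + D₂, hD.contFV, (hf.continuous.comp_continuousOn hz).sub hD.contFV.continuousOn,
    hg.continuous.comp_continuousOn hz, continuousOn_const, continuousOn_const, ?_⟩
  convert herr.null.add hD.null using 1
  funext N i
  simp only [GridSeq.inc, GridSeq.left, Pi.add_apply, Pi.sub_apply, Pi.mul_apply]
  ring

end PathwiseIto

/-! ### Closure properties of admissible integrands and existence of Itô integrals. -/

namespace PathwiseIto

lemma continuousOn_Ici_of_forall_Icc {f : ℝ → ℝ}
    (h : ∀ t : ℝ, 0 < t → ContinuousOn f (Icc 0 t)) : ContinuousOn f (Ici 0) := by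
  intro x hx
  rw [mem_Ici] at hx
  refine (h (x + 1) (by linarith) x ⟨hx, by linarith⟩).mono_of_mem_nhdsWithin ?_
  rw [← Ici_inter_Iic]
  exact inter_mem_nhdsWithin _ (Iic_mem_nhds (lt_add_one x))

/-- The variation function of a continuous function of bounded variation is continuous. -/
lemma continuousOn_variationOnFromTo {a : ℝ → ℝ} {s : Set ℝ} {x₀ : ℝ} (hx₀ : x₀ ∈ s)
    (ha : BoundedVariationOn a s) (hc : ContinuousOn a s) :
    ContinuousOn (variationOnFromTo a s x₀) s := by
  intro x hx
  have hl := ha.locallyBoundedVariationOn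
  have h1 := ha.tendsto_eVariationOn_Icc_zero_left ((hc x hx).mono inter_subset_left)
  have h2 := ha.tendsto_eVariationOn_Icc_zero_right x ((hc x hx).mono inter_subset_left)
  have h3 := ((ENNReal.tendsto_toReal ENNReal.zero_ne_top).comp h1).add
    ((ENNReal.tendsto_toReal ENNReal.zero_ne_top).comp h2)
  simp only [ENNReal.toReal_zero, add_zero] at h3
  rw [ContinuousWithinAt, tendsto_iff_dist_tendsto_zero]
  refine squeeze_zero' (Eventually.of_forall fun _ => dist_nonneg) ?_ h3
  filter_upwards [self_mem_nhdsWithin] with y hy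
  rw [Real.dist_eq, variationOnFromTo.sub_right hl hx₀ hy hx]
  simp only [Function.comp_apply]
  rcases le_total x y with hxy | hxy
  · rw [variationOnFromTo.eq_of_le _ _ hxy, abs_of_nonneg ENNReal.toReal_nonneg]
    exact le_add_of_nonneg_left ENNReal.toReal_nonneg
  · rw [variationOnFromTo.eq_of_ge _ _ hxy, abs_neg, abs_of_nonneg ENNReal.toReal_nonneg]
    exact le_add_of_nonneg_right ENNReal.toReal_nonneg

/-- Admissibility controls the variation on `[0,τ]` only; stopping the path at `τ` makes it of
finite variation on every interval. Its variation function is the required control. -/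
lemma contFV_comp_min {a : ℝ → ℝ} {τ : ℝ} (hτ : 0 < τ) (hc : ContinuousOn a (Icc 0 τ))
    (ha : BoundedVariationOn a (Icc 0 τ)) : ContFV (fun t => a (min t τ)) := by
  intro t _
  have h0 : (0 : ℝ) ∈ Icc 0 τ := left_mem_Icc.2 hτ.le
  have hmem : ∀ x : ℝ, 0 ≤ x → min x τ ∈ Icc 0 τ := fun x hx =>
    ⟨le_min hx hτ.le, min_le_right _ _⟩
  refine ⟨fun t => variationOnFromTo a (Icc 0 τ) 0 (min t τ),
    (continuousOn_variationOnFromTo h0 ha hc).comp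
      (continuous_id.min continuous_const).continuousOn fun x hx => hmem x hx.1,
    fun x y hx hxy _ => ?_⟩
  exact variationOnFromTo.abs_sub_le_sub_of_le ha.locallyBoundedVariationOn h0 (hmem x hx)
    (hmem y (hx.trans hxy)) (min_le_min_right τ hxy)

lemma ContFV.boundedVariationOn {A : ℝ → ℝ} (hA : ContFV A) {τ : ℝ} (hτ : 0 < τ) :
    BoundedVariationOn A (Icc 0 τ) := by
  obtain ⟨v, -, hv⟩ := hA τ hτ
  have hmono : MonotoneOn v (Icc 0 τ) := fun x hx y hy hxy => by
    linarith [hv x y hx.1 hxy hy.2, abs_nonneg (A y - A x)]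
  have h1 : eVariationOn A (Icc 0 τ) ≤ eVariationOn v (Icc 0 τ) := by
    refine iSup_mono fun p => Finset.sum_le_sum fun i _ => ?_
    have hi := p.2.2.2 i
    have hi' := p.2.2.2 (i + 1)
    have hle := p.2.2.1 (Nat.le_succ i)
    rw [edist_dist, edist_dist, Real.dist_eq, Real.dist_eq]
    exact ENNReal.ofReal_le_ofReal ((hv _ _ hi.1 hle hi'.2).trans (le_abs_self _))
  refine ne_top_of_le_ne_top ?_ h1
  have := hmono.locallyBoundedVariationOn 0 τ (left_mem_Icc.2 hτ.le) (right_mem_Icc.2 hτ.le)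
  rwa [inter_self] at this

/-- On `[0,τ]`, `ξ` is a `C¹` function of `X` and of finitely many continuous paths of finite
variation. -/
def AdmissibleOn (τ : ℝ) (X ξ : ℝ → ℝ) : Prop :=
  ∃ (n : ℕ) (g : (Fin n → ℝ) × ℝ → ℝ) (A : ℝ → Fin n → ℝ),
    ContDiff ℝ 1 g ∧ (∀ k, ContFV (fun t => A t k)) ∧ ∀ t ∈ Icc (0 : ℝ) τ, ξ t = g (A t, X t)

lemma Admissible.admissibleOn {X ξ : ℝ → ℝ} (h : Admissible X ξ) {τ : ℝ} (hτ : 0 < τ) :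
    AdmissibleOn τ X ξ := by
  obtain ⟨n, g, A, hg, hAc, hA, hξ⟩ := h τ hτ
  refine ⟨n, g, fun t => A (min t τ), hg, fun k => contFV_comp_min hτ
    ((continuousOn_pi.1 hAc k).mono Icc_subset_Ici_self) (hA k), fun t ht => ?_⟩
  simp only [min_eq_left ht.2, hξ t ht]

lemma admissible_of_forall_admissibleOn {X ξ : ℝ → ℝ}
    (h : ∀ τ : ℝ, 0 < τ → AdmissibleOn τ X ξ) : Admissible X ξ := by
  intro τ hτ
  obtain ⟨n, g, A, hg, hA, hξ⟩ := h τ hτ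
  exact ⟨n, g, A, hg, continuousOn_pi.2 fun k => (hA k).continuousOn,
    fun k => (hA k).boundedVariationOn hτ, hξ⟩

lemma Admissible.continuousOn {X ξ : ℝ → ℝ} (h : Admissible X ξ)
    (hX : ContinuousOn X (Ici 0)) : ContinuousOn ξ (Ici 0) := by
  refine continuousOn_Ici_of_forall_Icc fun τ hτ => ?_
  obtain ⟨n, g, A, hg, hAc, -, hξ⟩ := h τ hτ
  exact (hg.continuous.comp_continuousOn ((hAc.prodMk hX).mono Icc_subset_Ici_self)).congr hξ

namespace AdmissibleOn

variable {τ : ℝ} {X ξ ζ : ℝ → ℝ}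

lemma congr (h : AdmissibleOn τ X ξ) (he : EqOn ζ ξ (Icc 0 τ)) : AdmissibleOn τ X ζ := by
  obtain ⟨n, g, A, hg, hA, hξ⟩ := h
  exact ⟨n, g, A, hg, hA, fun t ht => (he ht).trans (hξ t ht)⟩

lemma self (τ : ℝ) (X : ℝ → ℝ) : AdmissibleOn τ X X :=
  ⟨0, fun p => p.2, fun _ => 0, contDiff_snd, fun k => k.elim0, fun _ _ => rfl⟩

lemma _root_.PathwiseIto.ContFV.admissibleOn {A : ℝ → ℝ} (hA : ContFV A) (τ : ℝ) (X : ℝ → ℝ) :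
    AdmissibleOn τ X A :=
  ⟨1, fun p => p.1 0, fun t _ => A t, by fun_prop, fun _ => hA, fun _ _ => rfl⟩

/-- The two families of finite variation paths are concatenated, so both integrands become functions
of one common vector. -/
lemma map₂ (h : AdmissibleOn τ X ξ) (h' : AdmissibleOn τ X ζ) {φ : ℝ × ℝ → ℝ}
    (hφ : ContDiff ℝ 1 φ) : AdmissibleOn τ X (fun t => φ (ξ t, ζ t)) := by
  obtain ⟨n, g, A, hg, hA, hξ⟩ := h
  obtain ⟨n', g', A', hg', hA', hζ⟩ := h'
  refine ⟨n + n', fun p => φ (g (fun k => p.1 (Fin.castAdd n' k), p.2),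
    g' (fun k => p.1 (Fin.natAdd n k), p.2)), fun t => Fin.append (A t) (A' t), ?_, ?_, ?_⟩
  · refine hφ.comp ((hg.comp ?_).prodMk (hg'.comp ?_)) <;> fun_prop
  · intro k
    refine Fin.addCases (fun i => ?_) (fun i => ?_) k
    · simpa using hA i
    · simpa using hA' i
  · intro t ht
    simp [hξ t ht, hζ t ht]

lemma comp (h : AdmissibleOn τ X ξ) {φ : ℝ → ℝ} (hφ : ContDiff ℝ 1 φ) :
    AdmissibleOn τ X (fun t => φ (ξ t)) :=
  h.map₂ h (φ := fun p => φ p.1) (hφ.comp contDiff_fst)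

lemma add (h : AdmissibleOn τ X ξ) (h' : AdmissibleOn τ X ζ) :
    AdmissibleOn τ X (fun t => ξ t + ζ t) :=
  h.map₂ h' (φ := fun p => p.1 + p.2) (by fun_prop)

lemma mul (h : AdmissibleOn τ X ξ) (h' : AdmissibleOn τ X ζ) :
    AdmissibleOn τ X (fun t => ξ t * ζ t) :=
  h.map₂ h' (φ := fun p => p.1 * p.2) (by fun_prop)

end AdmissibleOn

/-- The reciprocal, cut off smoothly near the origin. -/
lemma exists_contDiff_eq_inv {δ : ℝ} (hδ : 0 < δ) :
    ∃ ψ : ℝ → ℝ, ContDiff ℝ 1 ψ ∧ ∀ x, δ ≤ x → ψ x = x⁻¹ := by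
  -- The cutoff vanishes for `x ≤ δ/2` and equals `1` for `x ≥ δ`, so the product is `C¹` on the
  -- whole line.
  refine ⟨fun x => Real.smoothTransition (2 * x / δ - 1) * x⁻¹, ?_, fun x hx => ?_⟩
  · refine contDiff_iff_contDiffAt.2 fun x => ?_
    rcases lt_or_ge x (δ / 2) with hx | hx
    · refine (contDiffAt_const (c := (0 : ℝ))).congr_of_eventuallyEq ?_
      filter_upwards [Iio_mem_nhds hx] with y hy
      rw [Real.smoothTransition.zero_of_nonpos, zero_mul]
      have : 2 * y / δ ≤ 1 := (div_le_one hδ).2 (by linarith [mem_Iio.1 hy])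
      linarith
    · have hx0 : x ≠ 0 := (lt_of_lt_of_le (by positivity) hx).ne'
      refine ContDiffAt.mul ?_ (contDiffAt_inv ℝ hx0)
      exact (Real.smoothTransition.contDiff (n := 1)).contDiffAt.comp x (by fun_prop)
  · beta_reduce
    rw [Real.smoothTransition.one_of_one_le, one_mul]
    have : 2 ≤ 2 * x / δ := (le_div_iff₀ hδ).2 (by linarith)
    linarith

/-- By compactness `ξ` has a positive minimum on `[0,τ]`, and above it the reciprocal agrees with a
globally `C¹` function. -/
lemma AdmissibleOn.inv {τ : ℝ} {X ξ : ℝ → ℝ} (h : AdmissibleOn τ X ξ)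
    (hc : ContinuousOn ξ (Icc 0 τ)) (hτ : 0 < τ) (hpos : ∀ t ∈ Icc 0 τ, 0 < ξ t) :
    AdmissibleOn τ X (fun t => (ξ t)⁻¹) := by
  obtain ⟨t₀, ht₀, hmin⟩ := isCompact_Icc.exists_isMinOn ⟨0, left_mem_Icc.2 hτ.le⟩ hc
  obtain ⟨ψ, hψ, hψe⟩ := exists_contDiff_eq_inv (hpos t₀ ht₀)
  exact (h.comp hψ).congr fun t ht => (hψe _ (hmin ht)).symm

lemma ItoProcess.const {T : GridSeq} {S Q Λ : ℝ → ℝ} (c : ℝ) :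
    ItoProcess T S Q Λ (fun _ => c) (fun _ => 0) (fun _ => 0) (fun _ => 0) := by
  refine ⟨continuousOn_const, continuousOn_const, continuousOn_const, continuousOn_const, ?_⟩
  refine GridSeq.StrongNull.null fun t _ => ?_
  simp [GridSeq.psum_zero_array, GridSeq.inc, GridSeq.left]

/-- Sums up to `t` see only values on `[0,t]`, so dynamics may be checked with representations that
change with the horizon, as in the definition of admissibility. -/
lemma ItoProcess.of_forall_eqOn {T : GridSeq} {S Q Λ X h : ℝ → ℝ}
    (H : ∀ τ : ℝ, 0 < τ → ∃ X' h', ItoProcess T S Q Λ X' h' (fun _ => 0) (fun _ => 0) ∧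
      EqOn X X' (Icc 0 τ) ∧ EqOn h h' (Icc 0 τ)) :
    ItoProcess T S Q Λ X h (fun _ => 0) (fun _ => 0) := by
  have hnull : ∀ t : ℝ, 0 ≤ t → ∃ p, T.Null p ∧ ∀ N, ∀ i ∈ (T.grid N).upTo t,
      (T.inc X - T.left h * T.inc S - T.left (fun _ => 0) * T.inc Q
        - T.left (fun _ => 0) * T.inc Λ) N i = p N i := by
    intro t ht
    obtain ⟨X', h', hp, hX, hh⟩ := H (t + 1) (by linarith)
    refine ⟨_, hp.null, fun N i hi => ?_⟩
    obtain ⟨h1, h2⟩ := T.pt_mem_of_mem_upTo hi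
    have hsub : Icc 0 t ⊆ Icc 0 (t + 1) := Icc_subset_Icc_right (by linarith)
    simp only [GridSeq.inc, GridSeq.left, Pi.sub_apply, Pi.mul_apply, hX (hsub h1), hX (hsub h2),
      hh (hsub h1)]
  refine ⟨?_, ?_, continuousOn_const, continuousOn_const, fun t ht => ?_, fun t ht => ?_⟩
  · refine continuousOn_Ici_of_forall_Icc fun τ hτ => ?_
    obtain ⟨X', h', hp, hX, -⟩ := H τ hτ
    exact (hp.continuousOn.mono Icc_subset_Ici_self).congr hX
  · refine continuousOn_Ici_of_forall_Icc fun τ hτ => ?_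
    obtain ⟨X', h', hp, -, hh⟩ := H τ hτ
    exact (hp.continuousOn_stock.mono Icc_subset_Ici_self).congr hh
  · obtain ⟨p, hp, he⟩ := hnull t ht
    obtain ⟨K, hK⟩ := hp.bdd t ht
    refine ⟨K, hK.mono fun N hN => le_of_eq_of_le ?_ hN⟩
    exact Finset.sum_congr rfl fun i hi => congrArg abs (he N i hi)
  · obtain ⟨p, hp, he⟩ := hnull t ht
    exact (hp.tendsto t ht).congr fun N => Finset.sum_congr rfl fun i hi => (he N i hi).symm

/-- The pathwise Itô integral of an admissible integrand exists; it is an Itô process and itself of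
the form of an admissible integrand. -/
lemma Admissible.itoIntegral {T : GridSeq} {S Q ξ : ℝ → ℝ} (hξ : Admissible S ξ)
    (hS : ContinuousOn S (Ici 0)) (hQ : HasContinuousQV T S Q) (Λ : ℝ → ℝ) :
    (∀ t : ℝ, 0 ≤ t → HasItoIntegral T S ξ t (itoIntegral T S ξ t)) ∧
    (∀ τ : ℝ, 0 < τ → AdmissibleOn τ S (itoIntegral T S ξ)) ∧
    ItoProcess T S Q Λ (itoIntegral T S ξ) ξ (fun _ => 0) (fun _ => 0) := by
  have key : ∀ τ : ℝ, 0 < τ → ∃ I ζ, ItoProcess T S Q Λ I ζ (fun _ => 0) (fun _ => 0) ∧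
      AdmissibleOn τ S I ∧ (∀ t ∈ Icc 0 τ, HasItoIntegral T S ξ t (I t)) ∧
      EqOn ξ ζ (Icc 0 τ) := by
    intro τ hτ
    obtain ⟨n, g, A, hg, hA, hξ⟩ := hξ.admissibleOn hτ
    obtain ⟨f, hf, hfg⟩ := exists_contDiff_antideriv hg
    obtain ⟨D, hD, hI⟩ := exists_itoProcess (Λ := Λ) hS hQ hg hf hfg hA
    -- Subtracting the initial value makes the process equal to the integral from `0`.
    set c := f (A 0, S 0) - D 0 with hc
    refine ⟨fun t => f (A t, S t) - D t + -c, fun t => g (A t, S t),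
      (hI.add (ItoProcess.const _)).congr (fun _ _ => rfl) (by intro; simp)
        (by intro; simp) (by intro; simp),
      ?_, fun t ht => ?_, hξ⟩
    · have h1 : AdmissibleOn τ S (fun t => f (A t, S t)) := ⟨n, f, A, hf, hA, fun _ _ => rfl⟩
      exact h1.map₂ (hD.admissibleOn τ S) (φ := fun p => p.1 - p.2 + -c) (by fun_prop)
    · have h0 : Tendsto (T.psum (T.left (fun _ => 0) * T.inc Λ) t) atTop (𝓝 0) := by
        refine tendsto_const_nhds.congr fun N => ?_
        simp [GridSeq.psum, GridSeq.left]
      have h1 := hI.hasItoIntegral ht.1 h0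
      rw [sub_zero, sub_eq_add_neg] at h1
      refine h1.congr fun N => Finset.sum_congr rfl fun i hi => ?_
      have hmem := (T.pt_mem_of_mem_upTo hi).1
      rw [hξ _ ⟨hmem.1, hmem.2.trans ht.2⟩]
  have heq : ∀ {t I : ℝ}, HasItoIntegral T S ξ t I → PathwiseIto.itoIntegral T S ξ t = I :=
    fun h => Tendsto.limUnder_eq h
  refine ⟨fun t ht => ?_, fun τ hτ => ?_, ItoProcess.of_forall_eqOn fun τ hτ => ?_⟩
  · obtain ⟨I, ζ, -, -, hI, -⟩ := key (t + 1) (by linarith)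
    have := hI t ⟨ht, by linarith⟩
    rwa [heq this]
  · obtain ⟨I, ζ, -, hadm, hI, -⟩ := key τ hτ
    exact hadm.congr fun t ht => heq (hI t ht)
  · obtain ⟨I, ζ, hp, -, hI, hζ⟩ := key τ hτ
    exact ⟨I, ζ, hp, fun t ht => heq (hI t ht), hζ⟩

lemma itoIntegral_zero (T : GridSeq) (S ξ : ℝ → ℝ) : itoIntegral T S ξ 0 = 0 := by
  refine Tendsto.limUnder_eq (tendsto_const_nhds.congr fun N => ?_)
  exact (T.psum_zero (T.left ξ * T.inc S) N).symm

end PathwiseIto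

/-! ### The bond account and the main theorem. -/

namespace PathwiseIto

lemma bond_zero (r : ℝ → ℝ) : bond r 0 = 1 := by simp [bond]

lemma bond_pos (r : ℝ → ℝ) (t : ℝ) : 0 < bond r t := Real.exp_pos _

lemma continuousOn_bond {r : ℝ → ℝ} (hr : ∀ t : ℝ, 0 ≤ t → IntegrableOn r (Icc 0 t)) :
    ContinuousOn (bond r) (Ici 0) := by
  refine (contFV_setIntegral hr).continuousOn.rexp.congr fun t ht => ?_
  rw [bond, intervalIntegral.integral_of_le ht]

/-- The gains from the bond position of a strategy with cushion `C` and floor `c B`. -/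
lemma bondIntegral_eq {r m C η : ℝ → ℝ} {c : ℝ}
    (hr : ∀ t : ℝ, 0 ≤ t → IntegrableOn r (Icc 0 t)) (hm : ContinuousOn m (Ici 0))
    (hC : ContinuousOn C (Ici 0))
    (hη : ∀ t : ℝ, 0 ≤ t → η t = (C t + c * bond r t - m t * C t) / bond r t)
    {t : ℝ} (ht : 0 ≤ t) :
    bondIntegral r η t = (∫ s in Ioc 0 t, (1 - m s) * C s * r s) + c * (bond r t - 1) := by
  have hρ : ContinuousOn (fun s => (1 - m s) * C s) (Ici 0) :=
    (continuousOn_const.sub hm).mul hC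
  have h1 := (integrableOn_continuousOn_mul hr hρ ht).mono_set
    Ioc_subset_Icc_self
  have h2 := (integrableOn_continuousOn_mul hr (continuousOn_bond hr) ht).mono_set
    Ioc_subset_Icc_self
  have h3 := integral_mul_bond (fun t ht => hr t ht.le) le_rfl ht
  rw [bond_zero, intervalIntegral.integral_of_le ht] at h3
  rw [bondIntegral, intervalIntegral.integral_of_le ht, ← h3, ← integral_const_mul]
  rw [show (∫ s in Ioc 0 t, c * (r s * bond r s)) = ∫ s in Ioc 0 t, c * (bond r s * r s) by
    simp only [mul_comm (r _)]]
  rw [← integral_add h1 (h2.const_mul c)]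
  -- Pointwise, `η B r = (1 - m) C r + c B r`, and the last term integrates to `c (B - 1)`.
  refine setIntegral_congr_fun measurableSet_Ioc fun s hs => ?_
  have hb := (bond_pos r s).ne'
  simp only [hη s hs.1.le]
  field_simp
  ring

end PathwiseIto

open PathwiseIto
theorem theorem3 (T : GridSeq) (r S Q m : ℝ → ℝ) (α V₀ : ℝ)
    (hr : Measurable (fun t : Set.Ici (0 : ℝ) => r t))
    (hr_int : ∀ t : ℝ, 0 < t → MeasureTheory.IntegrableOn r (Set.Icc 0 t))
    (hS : ContinuousOn S (Set.Ici 0))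
    (hS_pos : ∀ t : ℝ, 0 ≤ t → 0 < S t)
    (hQ : HasContinuousQV T S Q)
    (hα : α ∈ Set.Icc (0 : ℝ) 1) (hV₀ : 0 ≤ V₀)
    (hm : Admissible S m) :
    -- the quotient is admissible
    Admissible S (fun t => m t / S t) ∧
    -- all integrals in the definition of the cushion exist
    (∀ t : ℝ, 0 ≤ t →
      HasItoIntegral T S (fun s => m s / S s) t (itoIntegral T S (fun s => m s / S s) t) ∧
      MeasureTheory.IntegrableOn (fun s => m s ^ 2 / S s ^ 2) (Set.Ioc 0 t) hQ.measure ∧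
      IntervalIntegrable (fun s => (1 - m s) * r s) MeasureTheory.volume 0 t) ∧
    -- definition of the cushion `C`, the value `V`, and the strategy `(ξ, η)`
    (∀ C V ξ η : ℝ → ℝ,
      (∀ t : ℝ, 0 ≤ t → C t = dppiCushion T r S hQ.measure m α V₀ t) →
      (∀ t : ℝ, 0 ≤ t → V t = C t + α * V₀ * bond r t) →
      (∀ t : ℝ, 0 ≤ t → ξ t = m t * C t / S t) →
      (∀ t : ℝ, 0 ≤ t → η t = (V t - m t * C t) / bond r t) →
      -- a self-financing DPPI strategy with portfolio value `V`
      SelfFinancing T r S ξ η ∧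
      (∀ t : ℝ, 0 ≤ t → portfolioValue r S ξ η t = V t) ∧
      IsDPPI r S m α V₀ ξ η ∧
      -- no gap risk
      (∀ t : ℝ, 0 ≤ t → 0 ≤ C t ∧ α * V₀ * bond r t ≤ V t) ∧
      -- uniqueness
      (∀ ξ' η' : ℝ → ℝ, SelfFinancing T r S ξ' η' → IsDPPI r S m α V₀ ξ' η' →
        ∀ t : ℝ, 0 ≤ t → ξ' t = ξ t ∧ η' t = η t)) := by
  have hr0 : ∀ t : ℝ, 0 ≤ t → IntegrableOn r (Icc 0 t) := fun t ht =>
    (hr_int (t + 1) (by linarith)).mono_set (Icc_subset_Icc_right (by linarith))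
  have hSne : ∀ t ∈ Ici (0 : ℝ), S t ≠ 0 := fun t ht => (hS_pos t ht).ne'
  have hmc : ContinuousOn m (Ici 0) := hm.continuousOn hS
  have hSinv : ∀ τ : ℝ, 0 < τ → AdmissibleOn τ S (fun t => (S t)⁻¹) := fun τ hτ =>
    (AdmissibleOn.self τ S).inv (hS.mono Icc_subset_Ici_self) hτ fun t ht => hS_pos t ht.1
  have hq : Admissible S (fun t => m t / S t) :=
    admissible_of_forall_admissibleOn fun τ hτ => (hm.admissibleOn hτ).mul (hSinv τ hτ)
  have hκc : ContinuousOn (fun s => m s ^ 2 / S s ^ 2) (Ici 0) :=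
    (hmc.pow 2).div (hS.pow 2) fun t ht => pow_ne_zero 2 (hSne t ht)
  have hρc : ContinuousOn (fun s => 1 - m s) (Ici 0) := continuousOn_const.sub hmc
  set Λ : ℝ → ℝ := fun t => ∫ s in Ioc 0 t, r s with hΛdef
  have hΛ : ContFV Λ := contFV_setIntegral hr0
  obtain ⟨hI, hIadm, hIproc⟩ := hq.itoIntegral hS hQ Λ
  set I : ℝ → ℝ := itoIntegral T S (fun s => m s / S s) with hIdef
  have hνs := hQ.nullSingletonClass
  have hκint : ∀ t : ℝ, 0 ≤ t →
      IntegrableOn (fun s => m s ^ 2 / S s ^ 2) (Icc 0 t) hQ.measure := fun t ht => by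
    simpa using integrableOn_continuousOn_mul (fun t _ => hQ.integrableOn_one t) hκc ht
  have hρint : ∀ t : ℝ, 0 ≤ t → IntegrableOn (fun s => (1 - m s) * r s) (Icc 0 t) :=
    fun t ht => integrableOn_continuousOn_mul hr0 hρc ht
  refine ⟨hq, fun t ht => ⟨hI t ht, (hκint t ht).mono_set Ioc_subset_Icc_self,
    (intervalIntegrable_iff_integrableOn_Icc_of_le ht).2 (hρint t ht)⟩, ?_⟩
  set E₁ : ℝ → ℝ := fun t => ∫ s in Ioc 0 t, m s ^ 2 / S s ^ 2 ∂hQ.measure with hE₁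
  set E₂ : ℝ → ℝ := fun t => ∫ s in Ioc 0 t, (1 - m s) * r s with hE₂
  set L : ℝ → ℝ := fun t => I t + (-(1 / 2)) * E₁ t + E₂ t with hL
  have hLproc : ItoProcess T S Q Λ L (fun t => m t / S t)
      (fun t => -(1 / 2) * (m t ^ 2 / S t ^ 2)) (fun t => 1 - m t) :=
    ((hIproc.add ((ItoProcess.integral_qv hQ hκc).const_mul (-(1 / 2)))).add
      (ItoProcess.integral_bond hr0 hρc)).congr (fun _ _ => rfl) (by intro; simp)
      (by intro; simp) (by intro; simp)
  have hL0 : L 0 = 0 := by simp [hL, hE₁, hE₂, hIdef, itoIntegral_zero]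
  have hLadm : ∀ τ : ℝ, 0 < τ → AdmissibleOn τ S L := fun τ hτ =>
    ((hIadm τ hτ).add (((contFV_setIntegral hκint).admissibleOn τ S).comp
      (φ := fun x => -(1 / 2) * x) (by fun_prop))).add ((contFV_setIntegral hρint).admissibleOn τ S)
  intro C V ξ η hC hV hξ hη
  have hCL : ∀ t ∈ Ici (0 : ℝ), C t = (1 - α) * V₀ * Real.exp (L t) := by
    intro t ht
    rw [hC t ht, dppiCushion, intervalIntegral.integral_of_le ht]
    congr 2
    simp only [hL, hE₁, hE₂]
    ring
  -- The `dQ` coefficient is `C (-½ m²/S² + ½ (m/S)²) = 0`; this makes the Itô integral of `ξ`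
  -- computable from `C` below.
  have hCproc : ItoProcess T S Q Λ C ξ (fun _ => 0) (fun t => (1 - m t) * C t) := by
    refine ((hLproc.exp hS hQ hΛ).const_mul ((1 - α) * V₀)).congr hCL (fun t ht => ?_)
      (fun t ht => ?_) (fun t ht => ?_)
    · simp only [hξ t ht, hCL t ht]; ring
    · have := hSne t ht
      field_simp
      ring
    · simp only [hCL t ht]; ring
  have hCc := hCproc.continuousOn
  have hρCc : ContinuousOn (fun s => (1 - m s) * C s) (Ici 0) := hρc.mul hCc
  have hξc := hCproc.continuousOn_stock
  have hBc := continuousOn_bond hr0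
  have hVc : ContinuousOn V (Ici 0) := (hCc.add (continuousOn_const.mul hBc)).congr hV
  have hηc : ContinuousOn η (Ici 0) :=
    ((hVc.sub (hmc.mul hCc)).div hBc fun t _ => (bond_pos r t).ne').congr hη
  have hpv : ∀ t : ℝ, 0 ≤ t → portfolioValue r S ξ η t = V t := by
    intro t ht
    have h1 := hSne t ht
    have h2 := (bond_pos r t).ne'
    rw [portfolioValue, hξ t ht, hη t ht]
    field_simp
    ring
  have hC0 : C 0 = (1 - α) * V₀ := by rw [hCL 0 (mem_Ici.2 le_rfl), hL0, Real.exp_zero, mul_one]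
  have hVsub : ∀ t : ℝ, 0 ≤ t → V t - α * V₀ * bond r t = C t := fun t ht => by
    rw [hV t ht]; ring
  have hCnonneg : ∀ t : ℝ, 0 ≤ t → 0 ≤ C t := fun t ht => by
    rw [hCL t ht]
    exact mul_nonneg (mul_nonneg (by linarith [hα.2]) hV₀) (Real.exp_pos _).le
  refine ⟨⟨?_, ?_, ?_, ?_, ?_⟩, hpv, ⟨?_, ?_, ?_⟩, fun t ht => ⟨hCnonneg t ht, ?_⟩, ?_⟩
  · exact (continuousOn_iff_continuous_domRestrict.1 hξc).measurable
  · exact (continuousOn_iff_continuous_domRestrict.1 hηc).measurable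
  · refine admissible_of_forall_admissibleOn fun τ hτ => ?_
    refine (((hm.admissibleOn hτ).mul (hSinv τ hτ)).mul ((hLadm τ hτ).comp
      (φ := fun x => (1 - α) * V₀ * Real.exp x) (by fun_prop))).congr fun t ht => ?_
    simp only [hξ t ht.1, hCL t ht.1]; ring
  · exact fun t ht => integrableOn_continuousOn_mul hr0 hηc ht
  · intro t ht
    refine ⟨_, hCproc.hasItoIntegral ht
      (tendsto_psum_left_mul_setIntegral T hr0 hρCc ht), ?_⟩
    rw [bondIntegral_eq hr0 hmc hCc (fun s hs => by rw [hη s hs, hV s hs]) ht, hpv t ht,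
      hpv 0 le_rfl, hV t ht, hV 0 le_rfl, bond_zero]
    ring
  · rw [hpv 0 le_rfl, hV 0 le_rfl, hC0, bond_zero]; ring
  · intro t ht
    rw [hpv t ht, hVsub t ht, hξ t ht]
  · intro t ht
    rw [hpv t ht, hVsub t ht, hη t ht]
  · rw [hV t ht]; linarith [hCnonneg t ht]
  · intro ξ' η' hsf hd
    set C' : ℝ → ℝ := fun t => portfolioValue r S ξ' η' t - α * V₀ * bond r t with hC'
    have hη' : ∀ t : ℝ, 0 ≤ t →
        η' t = (C' t + α * V₀ * bond r t - m t * C' t) / bond r t := fun t ht => by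
      rw [hd.bond t ht]; simp only [hC']; ring
    obtain ⟨hJ, -, hJproc⟩ := hsf.admissible.itoIntegral hS hQ Λ
    have hval : ∀ t : ℝ, 0 ≤ t → portfolioValue r S ξ' η' t =
        V₀ + itoIntegral T S ξ' t + bondIntegral r η' t := by
      intro t ht
      obtain ⟨J, hJt, he⟩ := hsf.value_eq t ht
      rw [he, hd.initial, tendsto_nhds_unique hJt (hJ t ht)]
    -- Nothing is known yet about continuity of `C'` or `η'`, so only integrability of `η' r` is
    -- used; continuity of `C'` then follows from the self-financing equation.
    have hbic : ContinuousOn (bondIntegral r η') (Ici 0) := by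
      refine (contFV_setIntegral (fun t ht => integrableOn_continuousOn_mul hsf.integrable hBc
        (t := t) ht)).continuousOn.congr fun t ht => ?_
      rw [bondIntegral, intervalIntegral.integral_of_le ht]
      refine integral_congr_ae (Eventually.of_forall fun s => ?_)
      simp only
      ring
    have hC'c : ContinuousOn C' (Ici 0) :=
      (((continuousOn_const.add hJproc.continuousOn).add hbic).congr hval).sub
        (continuousOn_const.mul hBc)
    have hρC'c : ContinuousOn (fun s => (1 - m s) * C' s) (Ici 0) := hρc.mul hC'c
    have hC't : ∀ t, C' t = portfolioValue r S ξ' η' t - α * V₀ * bond r t := fun _ => rfl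
    -- The growth `α V₀ (B - 1)` of the floor cancels, leaving `C' = (1-α) V₀ + ∫ ξ' dS + ∫ (1-m) C'
    -- r ds`.
    have hC'proc : ItoProcess T S Q Λ C' (fun t => m t * C' t / S t) (fun _ => 0)
        (fun t => (1 - m t) * C' t) := by
      refine (((ItoProcess.const ((1 - α) * V₀)).add hJproc).add (ItoProcess.integral_bond hr0 hρC'c)).congr
        (fun t ht => ?_) (fun t ht => ?_) (by intro; simp) (by intro; simp)
      · rw [hC't, hval t ht, bondIntegral_eq hr0 hmc hC'c hη' ht]
        ring
      · simp only [hd.stock t ht, hC']; ring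
    -- Here `e^{-L}` has `dS` coefficient `-e^{-L} m/S` and `dQ` coefficient `e^{-L} m²/S²`. The
    -- latter is cancelled by the covariation of `C'` and `e^{-L}`, and the `dS` and `dΛ` terms
    -- cancel in pairs.
    have hprod := hC'proc.mul ((hLproc.const_mul (-1)).exp hS hQ hΛ) hS hQ hΛ
    have hzero := hprod.congr (h' := fun _ => 0) (κ' := fun _ => 0) (ρ' := fun _ => 0)
      (fun _ _ => rfl)
      (fun t _ => by ring)
      (fun t ht => by
        have := hSne t ht
        field_simp
        ring)
      (fun t _ => by ring)
    have hCC : ∀ t : ℝ, 0 ≤ t → C' t = C t := by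
      intro t ht
      have h1 := hzero.eq_of_coeff_zero ht
      have h2 : C' 0 = (1 - α) * V₀ := by
        simp only [hC', hd.initial, bond_zero]; ring
      simp only [hL0, h2, mul_zero, Real.exp_zero, mul_one, neg_mul, one_mul, Real.exp_neg] at h1
      rw [hCL t ht, ← h1, mul_assoc, inv_mul_cancel₀ (Real.exp_pos _).ne', mul_one]
    intro t ht
    have hpv' : portfolioValue r S ξ' η' t = V t := by
      rw [hV t ht, ← hCC t ht]; simp only [hC']; ring
    rw [hd.stock t ht, hd.bond t ht, hpv', hVsub t ht, hξ t ht, hη t ht]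
    exact ⟨rfl, rfl⟩
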